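/- Let $a>0$, $\Omega=(-a,a)\times(-1,1)$ with points $(x,v)$. For $i=1,2$ let $\alpha_i,\beta_i\ge 0$ with $\alpha_i+\beta_i=1$, and let $K_1:L^1((-1,0);dv)\to L^1((0,1);dv)$ and $K_2:L^1((0,1);dv)\to L^1((-1,0);dv)$ be weakly compact stochastic operators (stochastic means positive and norm preserving on the positive cone). Let $R_1,R_2$ be the specular reflections between these spaces, $(R_i\varphi)(v)=\varphi(-v)$, and let $O_i=\alpha_iR_i+\beta_iK_i$. Let $T_O$ be the transport operator $T_Of=-v\,\partial f/\partial x$ in $L^1(\Omega)$ (with $v\,\partial f/\partial x$ in the sense of distributions), whose domain $D(T_O)$ consists of all $f\in L^1(\Omega)$ with $v\,\partial f/\partial x\in L^1(\Omega)$ whose traces $f(\pm a,\cdot)\in L^1((-1,1);|v|\,dv)$ satisfy the boundary conditions $$h_{-a}^+=O_1h_{-a}^-,\qquad h_a^-=O_2h_a^+,$$ where $h_{\pm a}^{+}$ and $h_{\pm a}^{-}$ are the restrictions of $v\mapsto|v|f(\pm a,v)$ to $(0,1)$ and $(-1,0)$ respectively. Write $|v|^{j}$ for the operator of multiplication by the function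 $|v|^{j}$. Assume that one of the following two cases holds: (1) $O_1=K_1$, the operators $|v|^{-1}K_1$ and $|v|^{-1}K_2|v|$ are bounded (from $L^1(dv)$ to $L^1(dv)$ on the respective intervals), and $G_0=O_1O_2$ is irreducible on $L^1((0,1);dv)$; (2) $O_2=K_2$, the operators $|v|^{-1}K_2$ and $|v|^{-1}K_1|v|$ are bounded, and $\widetilde G_0=O_2O_1$ is irreducible on $L^1((-1,0);dv)$. Here a positive operator on $L^1$ is irreducible if it leaves no closed ideal invariant other than $\{0\}$ and the whole space. Let $g\in L^1(\Omega)$. If $\frac{1}{|v|}g\in L^1(\Omega)$ and $\int_\Omega g=0$, then $g$ belongs to the range of $T_O$. -/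

import Mathlib

open MeasureTheory Set
open scoped ContDiff ComplexOrder

noncomputable section

namespace SlabTransport

/-- `L¹(S)` with respect to Lebesgue measure on the set `S`, with values in `𝕜` (real or complex). -/
abbrev L1 (𝕜 : Type*) [RCLike 𝕜] {X : Type*} [MeasureSpace X] (S : Set X) : Type _ :=
  Lp 𝕜 1 (volume.restrict S)

/-- The phase space `Ω = (-a, a) × (-1, 1)`, with points `z = (x, v)`. -/
def phaseSpace (a : ℝ) : Set (ℝ × ℝ) := Ioo (-a) a ×ˢ Ioo (-1) 1

/-- The velocities of the particles that move to the left. -/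
def negVel : Set ℝ := Ioo (-1) 0

/-- The velocities of the particles that move to the right. -/
def posVel : Set ℝ := Ioo 0 1

/-! ### Boundary operators -/

theorem measurePreserving_neg_posVel :
    MeasurePreserving (fun v : ℝ => -v) (volume.restrict posVel) (volume.restrict negVel) := by
  have h := (Measure.measurePreserving_neg (volume : Measure ℝ)).restrict_preimage
    (s := negVel) measurableSet_Ioo
  have e : (Neg.neg : ℝ → ℝ) ⁻¹' negVel = posVel := by
    ext v; simp only [negVel, posVel, mem_preimage, mem_Ioo]
    constructor <;> rintro ⟨h1, h2⟩ <;> constructor <;> linarith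
  rw [e] at h
  exact h

theorem measurePreserving_neg_negVel :
    MeasurePreserving (fun v : ℝ => -v) (volume.restrict negVel) (volume.restrict posVel) := by
  have h := (Measure.measurePreserving_neg (volume : Measure ℝ)).restrict_preimage
    (s := posVel) measurableSet_Ioo
  have e : (Neg.neg : ℝ → ℝ) ⁻¹' posVel = negVel := by
    ext v; simp only [negVel, posVel, mem_preimage, mem_Ioo]
    constructor <;> rintro ⟨h1, h2⟩ <;> constructor <;> linarith
  rw [e] at h
  exact h

variable (𝕜 : Type*) [RCLike 𝕜]

/-- Specular reflection at `x = -a`: `(R₁ φ)(v) = φ(-v)` for `v ∈ (0, 1)`. -/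
def reflectLeft : L1 𝕜 negVel →L[𝕜] L1 𝕜 posVel :=
  (Lp.compMeasurePreservingₗᵢ 𝕜 (fun v : ℝ => -v)
    measurePreserving_neg_posVel).toContinuousLinearMap

/-- Specular reflection at `x = a`: `(R₂ φ)(v) = φ(-v)` for `v ∈ (-1, 0)`. -/
def reflectRight : L1 𝕜 posVel →L[𝕜] L1 𝕜 negVel :=
  (Lp.compMeasurePreservingₗᵢ 𝕜 (fun v : ℝ => -v)
    measurePreserving_neg_negVel).toContinuousLinearMap

variable {𝕜}

/-- The boundary operator `O₁ = α R₁ + β K₁` at `x = -a`. -/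
def boundaryLeft (α β : ℝ) (K : L1 𝕜 negVel →L[𝕜] L1 𝕜 posVel) :
    L1 𝕜 negVel →L[𝕜] L1 𝕜 posVel :=
  (α : 𝕜) • reflectLeft 𝕜 + (β : 𝕜) • K

/-- The boundary operator `O₂ = α R₂ + β K₂` at `x = a`. -/
def boundaryRight (α β : ℝ) (K : L1 𝕜 posVel →L[𝕜] L1 𝕜 negVel) :
    L1 𝕜 posVel →L[𝕜] L1 𝕜 negVel :=
  (α : 𝕜) • reflectRight 𝕜 + (β : 𝕜) • K

/-- A stochastic operator: positive, and norm preserving on the positive cone.  (For complex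
scalars `0 ≤ z` means that `z` is real and nonnegative.) -/
def IsStochastic {I J : Set ℝ} (T : L1 𝕜 I →L[𝕜] L1 𝕜 J) : Prop :=
  ∀ φ : L1 𝕜 I, (∀ᵐ v ∂volume.restrict I, 0 ≤ φ v) →
    (∀ᵐ v ∂volume.restrict J, 0 ≤ T φ v) ∧ ‖T φ‖ = ‖φ‖

/-- A weakly compact operator: the image of the closed unit ball is relatively compact in the
weak topology. -/
def IsWeaklyCompact {E F : Type*} [NormedAddCommGroup E] [NormedSpace 𝕜 E]
    [NormedAddCommGroup F] [NormedSpace 𝕜 F] (T : E →L[𝕜] F) : Prop :=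
  IsCompact (closure ((fun x => toWeakSpace 𝕜 F (T x)) '' Metric.closedBall (0 : E) 1))

/-- The operator `|v|⁻¹ T` is a bounded operator from `L¹(I; dv)` to `L¹(J; dv)`. -/
def InvWeightBounded {I J : Set ℝ} (T : L1 𝕜 I →L[𝕜] L1 𝕜 J) : Prop :=
  ∃ B : L1 𝕜 I →L[𝕜] L1 𝕜 J, ∀ φ : L1 𝕜 I,
    ∀ᵐ v ∂volume.restrict J, B φ v = |v|⁻¹ • T φ v

/-- The operator `|v|⁻¹ T |v|` is a bounded operator from `L¹(I; dv)` to `L¹(J; dv)`.  Here `ψ`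
is the product `|v| φ`, which is in `L¹(I; dv)` whenever `φ` is and `I` is bounded. -/
def WeightConjBounded {I J : Set ℝ} (T : L1 𝕜 I →L[𝕜] L1 𝕜 J) : Prop :=
  ∃ B : L1 𝕜 I →L[𝕜] L1 𝕜 J, ∀ φ ψ : L1 𝕜 I,
    (∀ᵐ v ∂volume.restrict I, ψ v = |v| • φ v) →
      ∀ᵐ v ∂volume.restrict J, B φ v = |v|⁻¹ • T ψ v

/-- Irreducibility of a positive operator on `L¹(I; dv)`: there is no invariant closed ideal
besides `{0}` and the whole space.  The closed ideals of `L¹(I; dv)` are the sets of all `φ` that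
vanish almost everywhere outside a measurable set `A ⊆ I`. -/
def IsIrreducibleOperator {I : Set ℝ} (G : L1 𝕜 I →L[𝕜] L1 𝕜 I) : Prop :=
  ∀ A : Set ℝ, A ⊆ I → MeasurableSet A →
    (∀ φ : L1 𝕜 I, (∀ᵐ v ∂volume.restrict (I \ A), φ v = 0) →
      ∀ᵐ v ∂volume.restrict (I \ A), G φ v = 0) →
    volume A = 0 ∨ volume (I \ A) = 0

/-! ### The transport operator -/

/-- The partial derivative `∂φ/∂x` of a function of `z = (x, v)`. -/
def dx (φ : ℝ × ℝ → ℝ) (z : ℝ × ℝ) : ℝ := fderiv ℝ φ z (1, 0)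

/-- `v ∂f/∂x = w` in the sense of distributions on `Ω`. -/
def IsTransportDeriv (a : ℝ) (f w : L1 𝕜 (phaseSpace a)) : Prop :=
  ∀ φ : ℝ × ℝ → ℝ, ContDiff ℝ ∞ φ → HasCompactSupport φ → tsupport φ ⊆ phaseSpace a →
    ∫ z in phaseSpace a, (z.2 * dx φ z) • f z = -∫ z in phaseSpace a, φ z • w z

/-- `γm = f(-a, ·)` and `γp = f(a, ·)` are the traces in `L¹((-1, 1); |v| dv)` of a function `f`
with `v ∂f/∂x = w`.  They are determined, almost everywhere, by the Green formula
`∫_Ω (φ v ∂f/∂x + f v ∂φ/∂x) = ∫ v φ(a, v) f(a, v) dv - ∫ v φ(-a, v) f(-a, v) dv`. -/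
structure IsTrace (a : ℝ) (f w : L1 𝕜 (phaseSpace a)) (γm γp : ℝ → 𝕜) : Prop where
  integrable_left : IntegrableOn (fun v => v • γm v) (Ioo (-1) 1)
  integrable_right : IntegrableOn (fun v => v • γp v) (Ioo (-1) 1)
  green : ∀ φ : ℝ × ℝ → ℝ, ContDiff ℝ ∞ φ → HasCompactSupport φ →
    (∫ z in phaseSpace a, φ z • w z) + ∫ z in phaseSpace a, (z.2 * dx φ z) • f z =
      (∫ v in Ioo (-1) 1, φ (a, v) • v • γp v) - ∫ v in Ioo (-1) 1, φ (-a, v) • v • γm v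

/-- `h(v) = |v| γ(v)` almost everywhere on `I`. -/
def IsFlux {I : Set ℝ} (γ : ℝ → 𝕜) (h : L1 𝕜 I) : Prop :=
  ∀ᵐ v ∂volume.restrict I, h v = |v| • γ v

/-- A function `f` with `v ∂f/∂x = w` satisfies the boundary conditions
`h_{-a}^+ = O₁ h_{-a}^-` and `h_a^- = O₂ h_a^+`, where `h_{±a} = |v| f(±a, ·)` and the superscript
`+` or `-` stands for the restriction to `v > 0` or `v < 0`. -/
def BoundaryCondition (a : ℝ) (O₁ : L1 𝕜 negVel →L[𝕜] L1 𝕜 posVel)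
    (O₂ : L1 𝕜 posVel →L[𝕜] L1 𝕜 negVel) (f w : L1 𝕜 (phaseSpace a)) : Prop :=
  ∃ γm γp : ℝ → 𝕜, IsTrace a f w γm γp ∧
    ∃ (hmNeg : L1 𝕜 negVel) (hmPos : L1 𝕜 posVel) (hpNeg : L1 𝕜 negVel) (hpPos : L1 𝕜 posVel),
      IsFlux γm hmNeg ∧ IsFlux γm hmPos ∧ IsFlux γp hpNeg ∧ IsFlux γp hpPos ∧
        hmPos = O₁ hmNeg ∧ hpNeg = O₂ hpPos

section Linearity

variable {a : ℝ} {O₁ : L1 𝕜 negVel →L[𝕜] L1 𝕜 posVel} {O₂ : L1 𝕜 posVel →L[𝕜] L1 𝕜 negVel}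

theorem integrable_smul {X : Type*} [TopologicalSpace X] [MeasurableSpace X]
    [OpensMeasurableSpace X] {μ : Measure X}
    {ψ : X → ℝ} (hψ : Continuous ψ) {C : ℝ} (hC : ∀ x, ‖ψ x‖ ≤ C) {u : X → 𝕜}
    (hu : Integrable u μ) : Integrable (fun x => ψ x • u x) μ :=
  Integrable.bdd_smul hu C hψ.aestronglyMeasurable (Filter.Eventually.of_forall hC)

theorem integrable_test {φ : ℝ × ℝ → ℝ} (h1 : ContDiff ℝ ∞ φ) (h2 : HasCompactSupport φ)
    (w : L1 𝕜 (phaseSpace a)) :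
    Integrable (fun z => φ z • w z) (volume.restrict (phaseSpace a)) := by
  obtain ⟨C, hC⟩ := h2.exists_bound_of_continuous h1.continuous
  exact integrable_smul h1.continuous hC (L1.integrable_coeFn w)

theorem integrable_test_dx {φ : ℝ × ℝ → ℝ} (h1 : ContDiff ℝ ∞ φ) (h2 : HasCompactSupport φ)
    (f : L1 𝕜 (phaseSpace a)) :
    Integrable (fun z => (z.2 * dx φ z) • f z) (volume.restrict (phaseSpace a)) := by
  have hc : Continuous (fun z : ℝ × ℝ => z.2 * dx φ z) :=
    continuous_snd.mul ((h1.continuous_fderiv (by simp)).clm_apply continuous_const)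
  have hs : HasCompactSupport (fun z : ℝ × ℝ => z.2 * dx φ z) := by
    refine HasCompactSupport.mul_left (f := fun z : ℝ × ℝ => z.2) ?_
    exact (h2.fderiv (𝕜 := ℝ)).comp_left (g := fun L : ℝ × ℝ →L[ℝ] ℝ => L (1, 0)) (by simp)
  obtain ⟨C, hC⟩ := hs.exists_bound_of_continuous hc
  exact integrable_smul hc hC (L1.integrable_coeFn f)

theorem integrable_test_slice {φ : ℝ × ℝ → ℝ} (h1 : ContDiff ℝ ∞ φ) (h2 : HasCompactSupport φ)
    (x : ℝ) {u : ℝ → 𝕜} (hu : IntegrableOn u (Ioo (-1) 1)) :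
    Integrable (fun v => φ (x, v) • u v) (volume.restrict (Ioo (-1) 1)) := by
  obtain ⟨C, hC⟩ := h2.exists_bound_of_continuous h1.continuous
  exact integrable_smul (h1.continuous.comp (by fun_prop)) (fun v => hC (x, v)) hu

theorem integral_smul_add {ψ : ℝ × ℝ → ℝ} (f g : L1 𝕜 (phaseSpace a))
    (hf : Integrable (fun z => ψ z • f z) (volume.restrict (phaseSpace a)))
    (hg : Integrable (fun z => ψ z • g z) (volume.restrict (phaseSpace a))) :
    ∫ z in phaseSpace a, ψ z • (f + g) z =
      (∫ z in phaseSpace a, ψ z • f z) + ∫ z in phaseSpace a, ψ z • g z := by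
  rw [← integral_add hf hg]
  refine integral_congr_ae ?_
  filter_upwards [Lp.coeFn_add f g] with z hz
  rw [hz, Pi.add_apply, smul_add]

theorem integral_smul_smul {ψ : ℝ × ℝ → ℝ} (c : 𝕜) (f : L1 𝕜 (phaseSpace a)) :
    ∫ z in phaseSpace a, ψ z • (c • f) z = c • ∫ z in phaseSpace a, ψ z • f z := by
  rw [← integral_smul]
  refine integral_congr_ae ?_
  filter_upwards [Lp.coeFn_smul c f] with z hz
  rw [hz, Pi.smul_apply, smul_comm]

theorem IsTransportDeriv.add {f g w u : L1 𝕜 (phaseSpace a)} (hf : IsTransportDeriv a f w)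
    (hg : IsTransportDeriv a g u) : IsTransportDeriv a (f + g) (w + u) := by
  intro φ h1 h2 h3
  rw [integral_smul_add f g (integrable_test_dx h1 h2 f) (integrable_test_dx h1 h2 g),
    integral_smul_add w u (integrable_test h1 h2 w) (integrable_test h1 h2 u),
    hf φ h1 h2 h3, hg φ h1 h2 h3, neg_add]

theorem IsTransportDeriv.smul {f w : L1 𝕜 (phaseSpace a)} (c : 𝕜)
    (hf : IsTransportDeriv a f w) : IsTransportDeriv a (c • f) (c • w) := by
  intro φ h1 h2 h3
  rw [integral_smul_smul (ψ := fun z => z.2 * dx φ z), integral_smul_smul, hf φ h1 h2 h3, smul_neg]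

/-- The distributional derivative is unique. -/
theorem IsTransportDeriv.unique {f w u : L1 𝕜 (phaseSpace a)} (hw : IsTransportDeriv a f w)
    (hu : IsTransportDeriv a f u) : w = u := by
  have hopen : IsOpen (phaseSpace a) := isOpen_Ioo.prod isOpen_Ioo
  have key : ∀ᵐ z ∂volume.restrict (phaseSpace a), z ∈ phaseSpace a → w z - u z = 0 := by
    refine hopen.ae_eq_zero_of_integral_contDiff_smul_eq_zero
      (μ := volume.restrict (phaseSpace a)) (f := fun z => w z - u z) ?_ ?_
    · exact ((L1.integrable_coeFn w).sub
        (L1.integrable_coeFn u)).locallyIntegrable.locallyIntegrableOn _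
    · intro φ h1 h2 h3
      have e : ∫ z in phaseSpace a, φ z • w z = ∫ z in phaseSpace a, φ z • u z :=
        neg_injective ((hw φ h1 h2 h3).symm.trans (hu φ h1 h2 h3))
      simp_rw [smul_sub]
      rw [integral_sub (integrable_test h1 h2 w) (integrable_test h1 h2 u), e, sub_self]
  refine Lp.ext ?_
  filter_upwards [key, ae_restrict_mem hopen.measurableSet] with z hz hm
  exact sub_eq_zero.mp (hz hm)

theorem IsTrace.add {f g w u : L1 𝕜 (phaseSpace a)} {γm γp δm δp : ℝ → 𝕜}
    (hf : IsTrace a f w γm γp) (hg : IsTrace a g u δm δp) :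
    IsTrace a (f + g) (w + u) (γm + δm) (γp + δp) where
  integrable_left := by
    refine (hf.integrable_left.add hg.integrable_left).congr
      (Filter.Eventually.of_forall fun v => ?_)
    simp only [Pi.add_apply, smul_add]
  integrable_right := by
    refine (hf.integrable_right.add hg.integrable_right).congr
      (Filter.Eventually.of_forall fun v => ?_)
    simp only [Pi.add_apply, smul_add]
  green := by
    intro φ h1 h2
    rw [integral_smul_add f g (integrable_test_dx h1 h2 f) (integrable_test_dx h1 h2 g),
      integral_smul_add w u (integrable_test h1 h2 w) (integrable_test h1 h2 u)]
    simp only [Pi.add_apply, smul_add]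
    rw [integral_add (integrable_test_slice h1 h2 a hf.integrable_right)
        (integrable_test_slice h1 h2 a hg.integrable_right),
      integral_add (integrable_test_slice h1 h2 (-a) hf.integrable_left)
        (integrable_test_slice h1 h2 (-a) hg.integrable_left)]
    linear_combination hf.green φ h1 h2 + hg.green φ h1 h2

theorem IsTrace.smul {f w : L1 𝕜 (phaseSpace a)} {γm γp : ℝ → 𝕜} (c : 𝕜)
    (hf : IsTrace a f w γm γp) : IsTrace a (c • f) (c • w) (c • γm) (c • γp) where
  integrable_left := by
    refine (hf.integrable_left.smul c).congr (Filter.Eventually.of_forall fun v => ?_)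
    simp only [Pi.smul_apply, smul_comm c]
  integrable_right := by
    refine (hf.integrable_right.smul c).congr (Filter.Eventually.of_forall fun v => ?_)
    simp only [Pi.smul_apply, smul_comm c]
  green := by
    intro φ h1 h2
    have e : ∀ (x : ℝ) (γ : ℝ → 𝕜), ∫ v in Ioo (-1) 1, φ (x, v) • v • (c • γ) v =
        c • ∫ v in Ioo (-1) 1, φ (x, v) • v • γ v := by
      intro x γ
      rw [← integral_smul]
      refine integral_congr_ae (Filter.Eventually.of_forall fun v => ?_)
      simp only [Pi.smul_apply, smul_comm c]
    rw [integral_smul_smul, integral_smul_smul (ψ := fun z => z.2 * dx φ z), e, e, ← smul_add,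
      ← smul_sub, hf.green φ h1 h2]

theorem IsFlux.add {I : Set ℝ} {γ δ : ℝ → 𝕜} {h k : L1 𝕜 I} (hh : IsFlux γ h)
    (hk : IsFlux δ k) : IsFlux (γ + δ) (h + k) := by
  unfold IsFlux at *
  filter_upwards [hh, hk, Lp.coeFn_add h k] with v h1 h2 h3
  rw [h3, Pi.add_apply, Pi.add_apply, h1, h2, smul_add]

theorem IsFlux.smul {I : Set ℝ} {γ : ℝ → 𝕜} {h : L1 𝕜 I} (c : 𝕜) (hh : IsFlux γ h) :
    IsFlux (c • γ) (c • h) := by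
  unfold IsFlux at *
  filter_upwards [hh, Lp.coeFn_smul c h] with v h1 h3
  rw [h3, Pi.smul_apply, Pi.smul_apply, h1, smul_comm]

theorem BoundaryCondition.add {f g w u : L1 𝕜 (phaseSpace a)}
    (hf : BoundaryCondition a O₁ O₂ f w) (hg : BoundaryCondition a O₁ O₂ g u) :
    BoundaryCondition a O₁ O₂ (f + g) (w + u) := by
  obtain ⟨γm, γp, ht, h1, h2, h3, h4, e1, e2, e3, e4, b1, b2⟩ := hf
  obtain ⟨δm, δp, hs, k1, k2, k3, k4, d1, d2, d3, d4, c1, c2⟩ := hg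
  exact ⟨_, _, ht.add hs, h1 + k1, h2 + k2, h3 + k3, h4 + k4, e1.add d1, e2.add d2, e3.add d3,
    e4.add d4, by rw [map_add, b1, c1], by rw [map_add, b2, c2]⟩

theorem BoundaryCondition.smul {f w : L1 𝕜 (phaseSpace a)} (c : 𝕜)
    (hf : BoundaryCondition a O₁ O₂ f w) : BoundaryCondition a O₁ O₂ (c • f) (c • w) := by
  obtain ⟨γm, γp, ht, h1, h2, h3, h4, e1, e2, e3, e4, b1, b2⟩ := hf
  exact ⟨_, _, ht.smul c, c • h1, c • h2, c • h3, c • h4, e1.smul c, e2.smul c, e3.smul c,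
    e4.smul c, by rw [map_smul, b1], by rw [map_smul, b2]⟩

theorem domain_zero :
    IsTransportDeriv a (0 : L1 𝕜 (phaseSpace a)) 0 ∧ BoundaryCondition a O₁ O₂ 0 0 := by
  have z : ∀ ψ : ℝ × ℝ → ℝ,
      ∫ z in phaseSpace a, ψ z • (0 : L1 𝕜 (phaseSpace a)) z = 0 := by
    intro ψ
    have := integral_smul_smul (ψ := ψ) (0 : 𝕜) (0 : L1 𝕜 (phaseSpace a))
    simpa using this
  have fl : ∀ I : Set ℝ, IsFlux (0 : ℝ → 𝕜) (0 : L1 𝕜 I) := by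
    intro I
    unfold IsFlux
    filter_upwards [Lp.coeFn_zero 𝕜 1 (volume.restrict I)] with v hv
    rw [hv]; simp
  refine ⟨fun φ _ _ _ => ?_, 0, 0, ⟨by simp, by simp, fun φ _ _ => ?_⟩, 0, 0, 0, 0,
    fl _, fl _, fl _, fl _, by simp, by simp⟩
  · rw [z φ, z (fun z => z.2 * dx φ z), neg_zero]
  · rw [z φ, z (fun z => z.2 * dx φ z)]; simp

end Linearity

/-- The domain `D(T_O)`: all `f ∈ L¹(Ω)` with `v ∂f/∂x ∈ L¹(Ω)`, in the sense of distributions,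
that satisfy the boundary conditions. -/
def transportDomain (a : ℝ) (O₁ : L1 𝕜 negVel →L[𝕜] L1 𝕜 posVel)
    (O₂ : L1 𝕜 posVel →L[𝕜] L1 𝕜 negVel) : Submodule 𝕜 (L1 𝕜 (phaseSpace a)) where
  carrier := {f | ∃ w, IsTransportDeriv a f w ∧ BoundaryCondition a O₁ O₂ f w}
  zero_mem' := ⟨0, domain_zero⟩
  add_mem' := by
    rintro f g ⟨w, hw, bw⟩ ⟨u, hu, bu⟩
    exact ⟨w + u, hw.add hu, bw.add bu⟩
  smul_mem' := by
    rintro c f ⟨w, hw, bw⟩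
    exact ⟨c • w, hw.smul c, bw.smul c⟩

/-- The transport operator `T_O f = -v ∂f/∂x` on `D(T_O)`, an unbounded operator in `L¹(Ω)`. -/
def transportOperator (a : ℝ) (O₁ : L1 𝕜 negVel →L[𝕜] L1 𝕜 posVel)
    (O₂ : L1 𝕜 posVel →L[𝕜] L1 𝕜 negVel) :
    L1 𝕜 (phaseSpace a) →ₗ.[𝕜] L1 𝕜 (phaseSpace a) where
  domain := transportDomain a O₁ O₂
  toFun :=
    { toFun := fun f => -Classical.choose f.2
      map_add' := by
        intro f g
        rw [← neg_add]
        exact congrArg _ ((Classical.choose_spec (f + g).2).1.unique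
          ((Classical.choose_spec f.2).1.add (Classical.choose_spec g.2).1))
      map_smul' := by
        intro c f
        rw [RingHom.id_apply, smul_neg]
        exact congrArg _ ((Classical.choose_spec (c • f).2).1.unique
          ((Classical.choose_spec f.2).1.smul c)) }

/-- `T_O f = -w` whenever `f ∈ D(T_O)` and `v ∂f/∂x = w`. -/
theorem transportOperator_apply {a : ℝ} {O₁ : L1 𝕜 negVel →L[𝕜] L1 𝕜 posVel}
    {O₂ : L1 𝕜 posVel →L[𝕜] L1 𝕜 negVel} (f : (transportOperator a O₁ O₂).domain)
    {w : L1 𝕜 (phaseSpace a)} (hw : IsTransportDeriv a (f : L1 𝕜 (phaseSpace a)) w) :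
    transportOperator a O₁ O₂ f = -w :=
  congrArg (fun u : L1 𝕜 (phaseSpace a) => -u) ((Classical.choose_spec f.2).1.unique hw)

end SlabTransport

end

/-! Integration along the characteristics gives solutions `f(x,v) = v⁻¹ (m(v) - ∫_{-a}^x g(s,v) ds)`
of `v ∂f/∂x = -g`, and `m` has to be chosen to match the boundary conditions. Let `p = h_{-a}^+` and
`q = h_a^-` be the entering fluxes, and let `Gp`, `Gn` be the integrals of `g(·,v)` over `(-a,a)`
for `v > 0` and `v < 0`. The boundary conditions read `p = O₁ (q - Gn)`, `q = O₂ (p - Gp)`. In case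
(1), elimination of `q` leaves `(1 - O₁O₂) p = -O₁ (O₂ Gp + Gn)`. Its right side has integral `-∫ g
= 0`, because stochastic operators preserve integrals. The weighted bounds then put `|v|⁻¹ p` and
`|v|⁻¹ q` in `L¹`, and together with `|v|⁻¹ g ∈ L¹` this makes `f` integrable
(`exists_boundary_values`, `mem_range_of_boundary_values`). Case (2) exchanges the two walls.

It remains to show that an irreducible Markov operator `T` with weak compactness maps under `1 - T`
onto all elements of zero integral (`IsMarkov.exists_sub_eq`). The core is a lower bound for `1 - T`
on these elements (`exists_bound_below`). If it fails, there are `θ_n` with zero integral and norm 2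
that are asymptotically invariant. The parts `θ_n⁺`, `θ_n⁻` are disjoint asymptotically invariant
densities. A weak limit `h` of `θ_n⁺` is a fixed density, positive almost everywhere by
irreducibility. The meets of `h` with `θ_n⁺` and `θ_n⁻` converge weakly to positive multiples of
`h`, so each of them meets every nonzero `f` with `0 ≤ f ≤ h` in a fixed proportion. Since meets of
almost invariant elements are almost invariant, repeated splitting produces almost invariant
elements with arbitrarily small support, against the uniform integrability of the image of the unit
ball. With the lower bound, a long Cesàro mean of `T` is a contraction on zero-integral elements,
and a Neumann series solves the equation. -/

noncomputable section

namespace MarkovL1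

open Filter Topology

variable {X : Type*} [MeasurableSpace X] {μ : Measure X}

/-! ### Integration functionals on real `L¹` -/

/-- The integral over a set, as a functional on `L¹`. -/
def setInt (μ : Measure X) (B : Set X) : Lp ℝ 1 μ →L[ℝ] ℝ :=
  (L1.integralCLM (E := ℝ) (μ := μ.restrict B)) ∘L LpToLpRestrictCLM X ℝ ℝ μ 1 B

theorem setInt_apply (B : Set X) (f : Lp ℝ 1 μ) : setInt μ B f = ∫ x in B, f x ∂μ := by
  rw [setInt, ContinuousLinearMap.comp_apply, ← L1.integral_eq, L1.integral_eq_integral]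
  exact integral_congr_ae (LpToLpRestrictCLM_coeFn ℝ B f)

/-- The integral, as a functional on `L¹`. -/
def mass (μ : Measure X) : Lp ℝ 1 μ →L[ℝ] ℝ := L1.integralCLM

theorem mass_apply (f : Lp ℝ 1 μ) : mass μ f = ∫ x, f x ∂μ := by
  rw [mass, ← L1.integral_eq, L1.integral_eq_integral]

theorem setInt_add_compl {B : Set X} (hB : MeasurableSet B) (f : Lp ℝ 1 μ) :
    setInt μ B f + setInt μ Bᶜ f = mass μ f := by
  rw [setInt_apply, setInt_apply, mass_apply]
  exact integral_add_compl hB (L1.integrable_coeFn f)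

theorem setInt_mono {B : Set X} {f g : Lp ℝ 1 μ} (h : f ≤ g) : setInt μ B f ≤ setInt μ B g := by
  rw [setInt_apply, setInt_apply]
  exact integral_mono_ae (L1.integrable_coeFn f).integrableOn (L1.integrable_coeFn g).integrableOn
    (ae_restrict_of_ae ((Lp.coeFn_le f g).2 h))

theorem mass_mono {f g : Lp ℝ 1 μ} (h : f ≤ g) : mass μ f ≤ mass μ g := by
  rw [mass_apply, mass_apply]
  exact integral_mono_ae (L1.integrable_coeFn f) (L1.integrable_coeFn g) ((Lp.coeFn_le f g).2 h)

theorem setInt_nonneg {B : Set X} {f : Lp ℝ 1 μ} (h : 0 ≤ f) : 0 ≤ setInt μ B f := by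
  simpa using setInt_mono (B := B) h

theorem norm_eq_mass_abs (f : Lp ℝ 1 μ) : ‖f‖ = mass μ |f| := by
  rw [L1.norm_eq_integral_norm, mass_apply]
  refine integral_congr_ae ?_
  filter_upwards [Lp.coeFn_abs f] with x hx
  rw [hx, Real.norm_eq_abs]

theorem norm_eq_mass {f : Lp ℝ 1 μ} (h : 0 ≤ f) : ‖f‖ = mass μ f := by
  rw [norm_eq_mass_abs, abs_of_nonneg h]

theorem setInt_le_norm (B : Set X) (f : Lp ℝ 1 μ) : |setInt μ B f| ≤ ‖f‖ := by
  rw [setInt_apply, L1.norm_eq_integral_norm, ← Real.norm_eq_abs]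
  exact (norm_integral_le_integral_norm _).trans
    (setIntegral_le_integral (L1.integrable_coeFn f).norm (Eventually.of_forall fun x => norm_nonneg _))

theorem Lp_smul_nonneg {c : ℝ} (hc : 0 ≤ c) {f : Lp ℝ 1 μ} (hf : 0 ≤ f) : 0 ≤ c • f := by
  rw [← Lp.coeFn_nonneg] at hf ⊢
  filter_upwards [hf, Lp.coeFn_smul c f] with x h1 h2
  rw [h2]
  exact mul_nonneg hc h1

/-- An element with zero integral that is dominated by `e ≥ 0` is small. -/
theorem norm_le_of_le {f e : Lp ℝ 1 μ} (hf : mass μ f = 0) (hfe : f ≤ e) (he : 0 ≤ e) :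
    ‖f‖ ≤ 2 * ‖e‖ := by
  -- Since `f` has zero integral, its norm is twice the integral of `f⁺`, and `f⁺ ≤ e`.
  have h1 : |f| = (2 : ℝ) • f⁺ - f := by
    rw [← posPart_add_negPart, two_smul, eq_sub_iff_add_eq]
    calc f⁺ + f⁻ + f = f⁺ + f⁻ + (f⁺ - f⁻) := by rw [posPart_sub_negPart]
      _ = f⁺ + f⁺ := by abel
  have h2 : f⁺ ≤ e := sup_le hfe he
  rw [norm_eq_mass_abs, h1, map_sub, map_smul, hf, sub_zero, norm_eq_mass he, smul_eq_mul]
  linarith [mass_mono h2]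

/-- The pairing with a bounded measurable function, as a functional on `L¹`. -/
theorem exists_pairing {b : X → ℝ} (hb : Measurable b) {C : ℝ} (hC : ∀ x, |b x| ≤ C) :
    ∃ ℓ : Lp ℝ 1 μ →L[ℝ] ℝ, ∀ f, ℓ f = ∫ x, b x * f x ∂μ := by
  have hi : ∀ f : Lp ℝ 1 μ, Integrable (fun x => b x * f x) μ := fun f =>
    (L1.integrable_coeFn f).bdd_mul hb.aestronglyMeasurable (Eventually.of_forall hC)
  refine ⟨LinearMap.mkContinuous
    { toFun := fun f => ∫ x, b x * f x ∂μ
      map_add' := fun f g => ?_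
      map_smul' := fun c f => ?_ } C fun f => ?_, fun f => rfl⟩
  · rw [← integral_add (hi f) (hi g)]
    refine integral_congr_ae ?_
    filter_upwards [Lp.coeFn_add f g] with x hx
    rw [hx, Pi.add_apply, mul_add]
  · rw [RingHom.id_apply, ← integral_smul]
    refine integral_congr_ae ?_
    filter_upwards [Lp.coeFn_smul c f] with x hx
    rw [hx, Pi.smul_apply, smul_eq_mul, smul_eq_mul, mul_left_comm]
  · change ‖∫ x, b x * f x ∂μ‖ ≤ _
    rw [L1.norm_eq_integral_norm, ← integral_const_mul]
    refine norm_integral_le_of_norm_le ((L1.integrable_coeFn f).norm.const_mul C)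
      (Eventually.of_forall fun x => ?_)
    rw [norm_mul]
    exact mul_le_mul_of_nonneg_right (hC x) (norm_nonneg _)

theorem nonneg_of_setInt_nonneg {f : Lp ℝ 1 μ} (h : ∀ B, MeasurableSet B → 0 ≤ setInt μ B f) :
    0 ≤ f := by
  rw [← Lp.coeFn_nonneg]
  refine ae_nonneg_of_forall_setIntegral_nonneg (L1.integrable_coeFn f) fun B hB _ => ?_
  rw [← setInt_apply]
  exact h B hB

/-! ### Markov operators -/

/-- Positive operators on `L¹` that preserve the integral. -/
structure IsMarkov (T : Lp ℝ 1 μ →L[ℝ] Lp ℝ 1 μ) : Prop where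
  nonneg : ∀ f, 0 ≤ f → 0 ≤ T f
  mass_eq : ∀ f, mass μ (T f) = mass μ f

/-- Weak cluster points of `T f_n` along the hyperfilter exist for every sequence `f_n` in the
unit ball. -/
def HasWeakLimits (T : Lp ℝ 1 μ →L[ℝ] Lp ℝ 1 μ) : Prop :=
  ∀ f : ℕ → Lp ℝ 1 μ, (∀ n, ‖f n‖ ≤ 1) → ∃ g : Lp ℝ 1 μ, ∀ ℓ : Lp ℝ 1 μ →L[ℝ] ℝ,
    Tendsto (fun n => ℓ (T (f n))) (hyperfilter ℕ) (𝓝 (ℓ g))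

/-- No nontrivial measurable set supports an invariant closed ideal. -/
def IsIrred (T : Lp ℝ 1 μ →L[ℝ] Lp ℝ 1 μ) : Prop :=
  ∀ A : Set X, MeasurableSet A →
    (∀ f : Lp ℝ 1 μ, (∀ᵐ x ∂μ.restrict Aᶜ, f x = 0) → ∀ᵐ x ∂μ.restrict Aᶜ, T f x = 0) →
      μ A = 0 ∨ μ Aᶜ = 0

namespace IsMarkov

variable {T : Lp ℝ 1 μ →L[ℝ] Lp ℝ 1 μ}

theorem mono (hT : IsMarkov T) {f g : Lp ℝ 1 μ} (h : f ≤ g) : T f ≤ T g := by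
  have := hT.nonneg (g - f) (sub_nonneg.2 h)
  rwa [map_sub, sub_nonneg] at this

theorem abs_le (hT : IsMarkov T) (f : Lp ℝ 1 μ) : |T f| ≤ T |f| := by
  refine abs_le'.2 ⟨hT.mono (le_abs_self f), ?_⟩
  rw [← map_neg]
  exact hT.mono (neg_le_abs f)

theorem norm_le (hT : IsMarkov T) (f : Lp ℝ 1 μ) : ‖T f‖ ≤ ‖f‖ := by
  rw [norm_eq_mass_abs, norm_eq_mass_abs f, ← hT.mass_eq |f|]
  exact mass_mono (hT.abs_le f)

/-! ### Almost invariant and fixed elements. -/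

/-- The meet of almost invariant elements is almost invariant. -/
theorem norm_inf_sub_le (hT : IsMarkov T) (f g : Lp ℝ 1 μ) :
    ‖f ⊓ g - T (f ⊓ g)‖ ≤ 2 * (‖f - T f‖ + ‖g - T g‖) := by
  -- A one-sided bound suffices, as the difference has zero integral. It follows from `T (f ⊓ g) ≤ T
  -- f ≤ f + |f - T f|` and the same for `g`.
  have h : T (f ⊓ g) - f ⊓ g ≤ |f - T f| + |g - T g| := by
    rw [sub_le_iff_le_add', inf_add]
    refine le_inf ((hT.mono inf_le_left).trans ?_) ((hT.mono inf_le_right).trans ?_)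
    · have h1 := neg_le_abs (f - T f)
      have h2 := abs_nonneg (g - T g)
      rw [neg_sub, sub_le_iff_le_add'] at h1
      exact h1.trans (add_le_add le_rfl (le_add_of_nonneg_right h2))
    · have h1 := neg_le_abs (g - T g)
      have h2 := abs_nonneg (f - T f)
      rw [neg_sub, sub_le_iff_le_add'] at h1
      exact h1.trans (add_le_add le_rfl (le_add_of_nonneg_left h2))
  rw [norm_sub_rev]
  refine (norm_le_of_le ?_ h (add_nonneg (abs_nonneg _) (abs_nonneg _))).trans ?_
  · rw [map_sub, hT.mass_eq, sub_self]
  · gcongr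
    refine (norm_add_le _ _).trans ?_
    rw [norm_abs_eq_norm, norm_abs_eq_norm]

/-- This is the bound for meets applied to `-f` and the fixed element `0`, because `(-f) ⊓ 0 = -f⁺`.
-/
theorem norm_posPart_sub_le (hT : IsMarkov T) (f : Lp ℝ 1 μ) :
    ‖f⁺ - T f⁺‖ ≤ 2 * ‖f - T f‖ := by
  have h := hT.norm_inf_sub_le (-f) 0
  have e : (-f) ⊓ 0 = -f⁺ := by rw [posPart_def, neg_sup, neg_zero]
  rw [e] at h
  simp only [map_neg, map_zero, sub_zero, norm_zero, add_zero] at h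
  have e1 : -f⁺ - -T f⁺ = -(f⁺ - T f⁺) := by abel
  have e2 : -f - -T f = -(f - T f) := by abel
  rwa [e1, e2, norm_neg, norm_neg] at h

/-- A nonzero nonnegative fixed element of an irreducible Markov operator is positive almost
everywhere. -/
theorem ae_pos_of_fixed (hT : IsMarkov T) (hirr : IsIrred T) {u : Lp ℝ 1 μ} (hu : 0 ≤ u)
    (hfix : T u = u) (hne : u ≠ 0) : ∀ᵐ x ∂μ, 0 < u x := by
  set A : Set X := {x | 0 < u x} with hA
  have hAm : MeasurableSet A := measurableSet_lt measurable_const (Lp.stronglyMeasurable u).measurable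
  have hu0 : ∀ᵐ x ∂μ, 0 ≤ u x := (Lp.coeFn_nonneg u).2 hu
  have huA : setInt μ Aᶜ u = 0 := by
    rw [setInt_apply]
    refine integral_eq_zero_of_ae ?_
    filter_upwards [ae_restrict_of_ae hu0, ae_restrict_mem hAm.compl] with x h1 h2
    exact le_antisymm (not_lt.1 h2) h1
  have hinv : ∀ f : Lp ℝ 1 μ, (∀ᵐ x ∂μ.restrict Aᶜ, f x = 0) →
      ∀ᵐ x ∂μ.restrict Aᶜ, T f x = 0 := by
    intro f hf
    -- The support of `u` carries an invariant ideal: an `f` living there is approximated by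
    -- truncations at `n u`, and `T` keeps these below `n T u = n u`.
    have hlim : Tendsto (fun n : ℕ => |f| ⊓ ((n : ℝ) • u)) atTop (𝓝 |f|) := by
      rw [tendsto_iff_norm_sub_tendsto_zero]
      simp_rw [L1.norm_eq_integral_norm]
      have hz : (0 : ℝ) = ∫ x, (0 : ℝ) ∂μ := by simp
      rw [hz]
      refine tendsto_integral_of_dominated_convergence (fun x => 2 * |f x|) ?_ ?_ ?_ ?_
      · exact fun n => (Lp.aestronglyMeasurable _).norm
      · exact (L1.integrable_coeFn f).abs.const_mul 2
      · intro n
        filter_upwards [Lp.coeFn_sub (|f| ⊓ ((n : ℝ) • u)) |f|, Lp.coeFn_inf |f| ((n : ℝ) • u),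
          Lp.coeFn_abs f, Lp.coeFn_smul (n : ℝ) u, hu0] with x h1 h2 h3 h4 h5
        rw [norm_norm, h1, Pi.sub_apply, h2, Pi.inf_apply, h3, h4, Pi.smul_apply, smul_eq_mul,
          Real.norm_eq_abs]
        have h6 : (0 : ℝ) ≤ n * u x := by positivity
        have h7 : (0 : ℝ) ≤ |f x| ⊓ (n * u x) := le_inf (abs_nonneg _) h6
        have h8 : |f x| ⊓ (n * u x) ≤ |f x| := inf_le_left
        rw [_root_.abs_le]; constructor <;> linarith [abs_nonneg (f x)]
      · have hae : ∀ᵐ x ∂μ, x ∈ Aᶜ → f x = 0 := (ae_restrict_iff' hAm.compl).1 hf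
        have hall : ∀ᵐ x ∂μ, ∀ n : ℕ, ((|f| ⊓ ((n : ℝ) • u) - |f| : Lp ℝ 1 μ) : X → ℝ) x =
            |f x| ⊓ (n * u x) - |f x| := by
          rw [ae_all_iff]
          intro n
          filter_upwards [Lp.coeFn_sub (|f| ⊓ ((n : ℝ) • u)) |f|, Lp.coeFn_inf |f| ((n : ℝ) • u),
            Lp.coeFn_abs f, Lp.coeFn_smul (n : ℝ) u] with x h1 h2 h3 h4
          rw [h1, Pi.sub_apply, h2, Pi.inf_apply, h3, h4, Pi.smul_apply, smul_eq_mul]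
        filter_upwards [hae, hall, hu0] with x h1 h2 h3
        simp_rw [h2]
        by_cases hx : x ∈ A
        · obtain ⟨N, hN⟩ := exists_nat_ge (|f x| / u x)
          refine tendsto_const_nhds.congr' ?_
          filter_upwards [eventually_ge_atTop N] with n hn
          have hux : 0 < u x := hx
          have h4 : |f x| ≤ n * u x := by
            rw [div_le_iff₀ hux] at hN
            refine hN.trans ?_
            gcongr
          rw [inf_eq_left.2 h4, sub_self, norm_zero]
        · rw [h1 hx]
          refine tendsto_const_nhds.congr fun n => ?_
          have h6 : (0 : ℝ) ≤ n * u x := by positivity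
          rw [abs_zero, inf_eq_left.2 h6, sub_self, norm_zero]
    have hz : setInt μ Aᶜ (T |f|) = 0 := by
      have h1 : Tendsto (fun n : ℕ => setInt μ Aᶜ (T (|f| ⊓ ((n : ℝ) • u)))) atTop
          (𝓝 (setInt μ Aᶜ (T |f|))) :=
        (((setInt μ Aᶜ).continuous.comp T.continuous).tendsto _).comp hlim
      refine tendsto_nhds_unique h1 (tendsto_const_nhds.congr fun n => ?_)
      have h2 : 0 ≤ |f| ⊓ ((n : ℝ) • u) :=
        le_inf (abs_nonneg f) (Lp_smul_nonneg (Nat.cast_nonneg n) hu)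
      refine le_antisymm (setInt_nonneg (hT.nonneg _ h2)) ?_
      refine (setInt_mono (hT.mono inf_le_right)).trans ?_
      rw [map_smul, hfix, map_smul, huA, smul_zero]
    rw [setInt_apply] at hz
    have h0 : 0 ≤ T |f| := hT.nonneg _ (abs_nonneg f)
    have h3 := (integral_eq_zero_iff_of_nonneg_ae
      (ae_restrict_of_ae ((Lp.coeFn_nonneg _).2 h0)) (L1.integrable_coeFn _).integrableOn).1 hz
    filter_upwards [h3, ae_restrict_of_ae ((Lp.coeFn_le _ _).2 (hT.abs_le f)),
      ae_restrict_of_ae (Lp.coeFn_abs (T f))] with x h4 h5 h6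
    rw [h6, h4] at h5
    exact abs_eq_zero.1 (le_antisymm h5 (abs_nonneg _))
  rcases hirr A hAm hinv with h | h
  · exfalso
    apply hne
    refine Lp.ext ?_
    filter_upwards [measure_eq_zero_iff_ae_notMem.1 h, hu0, Lp.coeFn_zero ℝ 1 μ] with x h1 h2 h3
    rw [h3]
    exact le_antisymm (not_lt.1 h1) h2
  · filter_upwards [measure_eq_zero_iff_ae_notMem.1 h] with x hx
    exact not_not.1 hx

/-- A fixed element of an irreducible Markov operator with zero integral vanishes. -/
theorem eq_zero_of_fixed (hT : IsMarkov T) (hirr : IsIrred T) {f : Lp ℝ 1 μ} (hfix : T f = f)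
    (hf : mass μ f = 0) : f = 0 := by
  have hpos : ∀ g : Lp ℝ 1 μ, T g = g → T g⁺ = g⁺ := by
    intro g hg
    have h := hT.norm_posPart_sub_le g
    rw [hg, sub_self, norm_zero, mul_zero] at h
    exact (sub_eq_zero.1 (norm_le_zero_iff.1 h)).symm
  have h0 : ∀ g : Lp ℝ 1 μ, 0 ≤ g → mass μ g = 0 → g = 0 := by
    intro g h1 h2
    rw [← norm_eq_zero, norm_eq_mass h1, h2]
  by_cases hne : f⁺ = 0
  · have h1 : f ≤ 0 := posPart_eq_zero.1 hne
    have h2 := h0 (-f) (neg_nonneg.2 h1) (by rw [map_neg, hf, neg_zero])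
    exact neg_eq_zero.1 h2
  -- The positive part is itself fixed. If it is nonzero, it is positive almost everywhere, so `f`
  -- has a constant sign and zero integral forces `f = 0`.
  · have h1 := hT.ae_pos_of_fixed hirr (posPart_nonneg f) (hpos f hfix) hne
    have h2 : 0 ≤ f := by
      rw [← Lp.coeFn_nonneg]
      filter_upwards [h1, Lp.coeFn_sup f 0, Lp.coeFn_zero ℝ 1 μ] with x h3 h4 h5
      rw [posPart_def, h4, Pi.sup_apply, h5, Pi.zero_apply, lt_sup_iff] at h3
      rcases h3 with h3 | h3
      · exact h3.le
      · exact absurd h3 (lt_irrefl _)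
    exact h0 f h2 hf

/-! ### Weak limits and uniform integrability. -/

/-- Asymptotically invariant sequences in the unit ball converge weakly, along the hyperfilter, to
fixed elements. -/
theorem exists_weak_limit (hw : HasWeakLimits T) {f : ℕ → Lp ℝ 1 μ}
    (hf : ∀ n, ‖f n‖ ≤ 1)
    (hd : Tendsto (fun n => ‖f n - T (f n)‖) (hyperfilter ℕ) (𝓝 0)) :
    ∃ g : Lp ℝ 1 μ, T g = g ∧ ∀ ℓ : Lp ℝ 1 μ →L[ℝ] ℝ,
      Tendsto (fun n => ℓ (f n)) (hyperfilter ℕ) (𝓝 (ℓ g)) := by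
  obtain ⟨g, hg⟩ := hw f hf
  have hfg : ∀ ℓ : Lp ℝ 1 μ →L[ℝ] ℝ, Tendsto (fun n => ℓ (f n)) (hyperfilter ℕ) (𝓝 (ℓ g)) := by
    intro ℓ
    have h1 : Tendsto (fun n => ℓ (f n - T (f n))) (hyperfilter ℕ) (𝓝 (ℓ 0)) :=
      (ℓ.continuous.tendsto 0).comp (tendsto_zero_iff_norm_tendsto_zero.2 hd)
    have h2 := h1.add (hg ℓ)
    rw [map_zero, zero_add] at h2
    refine h2.congr fun n => ?_
    rw [← map_add, sub_add_cancel]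
  refine ⟨g, ?_, hfg⟩
  refine (SeparatingDual.eq_iff_forall_dual_eq (R := ℝ)).2 fun ℓ => ?_
  -- `T (f n)` tends weakly to `T g`, since `ℓ ∘L T` is again a functional, and to `g` by the choice
  -- of `g`.
  exact tendsto_nhds_unique (hfg (ℓ ∘L T)) (hg ℓ)

theorem nonneg_of_weak_limit {f : ℕ → Lp ℝ 1 μ} (hf : ∀ n, 0 ≤ f n) {g : Lp ℝ 1 μ}
    (hg : ∀ ℓ : Lp ℝ 1 μ →L[ℝ] ℝ, Tendsto (fun n => ℓ (f n)) (hyperfilter ℕ) (𝓝 (ℓ g))) :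
    0 ≤ g :=
  nonneg_of_setInt_nonneg fun B _ =>
    ge_of_tendsto' (hg (setInt μ B)) fun n => setInt_nonneg (hf n)

theorem setInt_mono_set {A B : Set X} (hAB : A ⊆ B) {f : Lp ℝ 1 μ}
    (hf : 0 ≤ f) : setInt μ A f ≤ setInt μ B f := by
  rw [setInt_apply, setInt_apply]
  exact setIntegral_mono_set (L1.integrable_coeFn f).integrableOn
    (ae_restrict_of_ae ((Lp.coeFn_nonneg f).2 hf)) (Eventually.of_forall hAB)

/-- The image of the positive part of the unit ball under a positive operator with weak limits is
uniformly integrable with respect to any strictly positive density. -/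
theorem uniform_integrability (hT : IsMarkov T) (hw : HasWeakLimits T) {h : Lp ℝ 1 μ}
    (hpos : ∀ᵐ x ∂μ, 0 < h x) {ε : ℝ} (hε : 0 < ε) :
    ∃ δ > 0, ∀ f : Lp ℝ 1 μ, 0 ≤ f → ‖f‖ ≤ 1 → ∀ B, MeasurableSet B → setInt μ B h ≤ δ →
      setInt μ B (T f) ≤ ε := by
  by_contra! hcon
  choose f hf0 hf1 B hB hBh hBf using fun n : ℕ => hcon ((1 / 2 : ℝ) ^ n) (by positivity)
  obtain ⟨g, hg⟩ := hw f hf1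
  -- By Borel–Cantelli for the measure with density `h`, the tail unions decrease to a null set. The
  -- weak limit `g` nevertheless keeps integral at least `ε` on each of them, which is the
  -- contradiction.
  set E : ℕ → Set X := fun m => ⋃ n ≥ m, B n with hE
  have hEm : ∀ m, MeasurableSet (E m) := fun m =>
    MeasurableSet.iUnion fun n => MeasurableSet.iUnion fun _ => hB n
  have hanti : Antitone E := fun m k hmk =>
    biUnion_subset_biUnion_left fun n (hn : k ≤ n) => (hmk.trans hn : m ≤ n)
  set ν : Measure X := μ.withDensity fun x => ENNReal.ofReal (h x) with hν
  have hac : μ ≪ ν := by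
    refine withDensity_absolutelyContinuous'
      (Lp.stronglyMeasurable h).measurable.ennreal_ofReal.aemeasurable ?_
    filter_upwards [hpos] with x hx
    exact (ENNReal.ofReal_pos.2 hx).ne'
  have hνB : ∀ n, ν (B n) ≤ ENNReal.ofReal ((1 / 2 : ℝ) ^ n) := by
    intro n
    rw [hν, withDensity_apply _ (hB n), ← ofReal_integral_eq_lintegral_ofReal
      (L1.integrable_coeFn h).integrableOn
      (ae_restrict_of_ae (hpos.mono fun x hx => hx.le)), ← setInt_apply]
    exact ENNReal.ofReal_le_ofReal (hBh n)
  have hsum : ∑' n, ν (B n) ≠ ⊤ := by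
    refine ne_top_of_le_ne_top ?_ (ENNReal.tsum_le_tsum hνB)
    rw [← ENNReal.ofReal_tsum_of_nonneg (fun n => by positivity) summable_geometric_two]
    exact ENNReal.ofReal_ne_top
  have hnull : μ (⋂ m, E m) = 0 := by
    have h1 := hac (measure_limsup_atTop_eq_zero hsum)
    rwa [limsup_eq_iInf_iSup_of_nat] at h1
  have hlim := tendsto_setIntegral_of_antitone hEm hanti
    ⟨0, (L1.integrable_coeFn g).integrableOn⟩
  rw [setIntegral_measure_zero _ hnull] at hlim
  have hge : ∀ m, ε ≤ ∫ x in E m, g x ∂μ := by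
    intro m
    rw [← setInt_apply]
    refine ge_of_tendsto (hg (setInt μ (E m))) ?_
    have h1 : ∀ᶠ n in (hyperfilter ℕ : Filter ℕ), m ≤ n :=
      Nat.hyperfilter_le_atTop (eventually_ge_atTop m)
    filter_upwards [h1] with n hn
    exact (hBf n).le.trans (setInt_mono_set
      (subset_biUnion_of_mem (u := fun n => B n) (show n ∈ {k | k ≥ m} from hn))
      (hT.nonneg _ (hf0 n)))
  exact absurd (ge_of_tendsto' hlim hge) (not_le.2 hε)

/-- Asymptotically invariant densities do not become orthogonal to a strictly positive density. -/
theorem exists_pos_le_mass_inf (hT : IsMarkov T) (hw : HasWeakLimits T) {h : Lp ℝ 1 μ}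
    (hpos : ∀ᵐ x ∂μ, 0 < h x) :
    ∃ δ > 0, ∀ u : Lp ℝ 1 μ, 0 ≤ u → ‖u‖ = 1 → ‖u - T u‖ ≤ 1 / 8 → δ ≤ mass μ (h ⊓ u) := by
  obtain ⟨δ, hδ, H⟩ := hT.uniform_integrability hw hpos (ε := 1 / 2) (by norm_num)
  refine ⟨min δ (1 / 8), lt_min hδ (by norm_num), fun u hu h1 hd => ?_⟩
  by_contra! hlt
  have hlt1 := hlt.trans_le (min_le_left _ _)
  have hlt2 := hlt.trans_le (min_le_right _ _)
  -- If the meet had small integral, then `h` would be small on `B` and `u` small off `B`. So `u`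
  -- would have more than `7/8` of its mass on `B`, whereas `T u` has at most `1/2` there and
  -- differs from `u` by at most `1/8`.
  set B : Set X := {x | h x < u x} with hB
  have hBm : MeasurableSet B :=
    measurableSet_lt (Lp.stronglyMeasurable h).measurable (Lp.stronglyMeasurable u).measurable
  have hh : 0 ≤ h := by
    rw [← Lp.coeFn_nonneg]
    exact hpos.mono fun x hx => hx.le
  have hsplit := setInt_add_compl hBm (h ⊓ u)
  have e1 : setInt μ B (h ⊓ u) = setInt μ B h := by
    rw [setInt_apply, setInt_apply]
    refine integral_congr_ae ?_
    filter_upwards [ae_restrict_of_ae (Lp.coeFn_inf h u), ae_restrict_mem hBm] with x h2 h3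
    rw [h2, Pi.inf_apply, inf_eq_left]
    exact le_of_lt h3
  have e2 : setInt μ Bᶜ (h ⊓ u) = setInt μ Bᶜ u := by
    rw [setInt_apply, setInt_apply]
    refine integral_congr_ae ?_
    filter_upwards [ae_restrict_of_ae (Lp.coeFn_inf h u), ae_restrict_mem hBm.compl] with x h2 h3
    rw [h2, Pi.inf_apply, inf_eq_right]
    exact not_lt.1 h3
  rw [e1, e2] at hsplit
  have p1 := setInt_nonneg (B := B) hh
  have p2 := setInt_nonneg (B := Bᶜ) hu
  have h3 := H u hu h1.le B hBm (by linarith)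
  have h4 := setInt_le_norm B (u - T u)
  have h5 := setInt_add_compl hBm u
  rw [← norm_eq_mass hu, h1] at h5
  rw [map_sub] at h4
  have h6 := le_abs_self (setInt μ B u - setInt μ B (T u))
  linarith

/-! ### Splitting into almost invariant pieces with small support. -/

/-- Meets with a sequence that converges weakly to a multiple of `h` keep a fixed proportion of the
mass. -/
theorem eventually_le_norm_inf {h : Lp ℝ 1 μ} (hpos : ∀ᵐ x ∂μ, 0 < h x) {v : ℕ → Lp ℝ 1 μ}
    (hv0 : ∀ n, 0 ≤ v n) (hvh : ∀ n, v n ≤ h) {c : ℝ} (hc : 0 < c)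
    (hv : ∀ ℓ : Lp ℝ 1 μ →L[ℝ] ℝ, Tendsto (fun n => ℓ (v n)) (hyperfilter ℕ) (𝓝 (ℓ (c • h))))
    {f : Lp ℝ 1 μ} (hf0 : 0 ≤ f) (hfh : f ≤ h) (hne : f ≠ 0) :
    ∀ᶠ n in (hyperfilter ℕ : Filter ℕ), c / 2 * ‖f‖ ≤ ‖f ⊓ v n‖ := by
  -- The quotient `b = f / h` linearises the meet: `b ≤ 1` and `v n ≤ h` give `b v_n ≤ f ⊓ v_n`,
  -- while the integral of `b v_n` tends to that of `c b h = c f`. The truncation makes `b` bounded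
  -- everywhere.
  set b : X → ℝ := fun x => max 0 (min 1 (f x / h x)) with hb
  have hbm : Measurable b := measurable_const.max (measurable_const.min
    ((Lp.stronglyMeasurable f).measurable.div (Lp.stronglyMeasurable h).measurable))
  have hb0 : ∀ x, 0 ≤ b x := fun x => le_max_left _ _
  have hb1 : ∀ x, b x ≤ 1 := fun x => max_le zero_le_one (min_le_left _ _)
  obtain ⟨ℓ, hℓ⟩ := exists_pairing (μ := μ) hbm
    (C := 1) fun x => by rw [abs_of_nonneg (hb0 x)]; exact hb1 x
  have hbf : ∀ᵐ x ∂μ, b x * h x = f x := by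
    filter_upwards [hpos, (Lp.coeFn_nonneg f).2 hf0, (Lp.coeFn_le f h).2 hfh] with x h1 h2 h3
    have h4 : f x / h x ≤ 1 := (div_le_one h1).2 h3
    have h5 : 0 ≤ f x / h x := div_nonneg h2 h1.le
    rw [hb]
    dsimp only
    rw [min_eq_right h4, max_eq_right h5, div_mul_cancel₀ _ h1.ne']
  have hℓh : ℓ h = ‖f‖ := by
    rw [hℓ, norm_eq_mass hf0, mass_apply]
    exact integral_congr_ae hbf
  have hlim := hv ℓ
  rw [map_smul, hℓh, smul_eq_mul] at hlim
  have hfp : 0 < ‖f‖ := norm_pos_iff.2 hne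
  have hlt : c / 2 * ‖f‖ < c * ‖f‖ := by nlinarith
  filter_upwards [hlim.eventually (lt_mem_nhds hlt)] with n hn
  refine hn.le.trans ?_
  rw [norm_eq_mass (le_inf hf0 (hv0 n)), hℓ, mass_apply]
  refine integral_mono_ae ((L1.integrable_coeFn (v n)).bdd_mul hbm.aestronglyMeasurable
    (c := 1) (Eventually.of_forall fun x => ?_)) (L1.integrable_coeFn _) ?_
  · rw [Real.norm_eq_abs, abs_of_nonneg (hb0 x)]; exact hb1 x
  · filter_upwards [hbf, Lp.coeFn_inf f (v n), (Lp.coeFn_nonneg _).2 (hv0 n),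
      (Lp.coeFn_le _ _).2 (hvh n)] with x h1 h2 h3 h4
    rw [h2, Pi.inf_apply]
    refine le_inf ?_ ?_
    · rw [← h1]; exact mul_le_mul_of_nonneg_left h4 (hb0 x)
    · exact mul_le_of_le_one_left h3 (hb1 x)

/-- The set where an element of `L¹` is positive. -/
def posSet (f : Lp ℝ 1 μ) : Set X := {x | 0 < f x}

theorem measurableSet_posSet (f : Lp ℝ 1 μ) : MeasurableSet (posSet f) :=
  measurableSet_lt measurable_const (Lp.stronglyMeasurable f).measurable

/-- The supports of the two meets are disjoint subsets of the support of `f`. Hence one of them has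
at most half of its measure with respect to `h`. -/
theorem setInt_posSet_inf_add_le {h f v w : Lp ℝ 1 μ} (hh : 0 ≤ h) (hvw : v ⊓ w = 0) :
    setInt μ (posSet (f ⊓ v)) h + setInt μ (posSet (f ⊓ w)) h ≤ setInt μ (posSet f) h := by
  have hi : ∀ g : Lp ℝ 1 μ, Integrable ((posSet g).indicator h) μ := fun g =>
    (L1.integrable_coeFn h).indicator (measurableSet_posSet g)
  simp_rw [setInt_apply, ← integral_indicator (measurableSet_posSet _)]
  rw [← integral_add (hi _) (hi _)]
  refine integral_mono_ae ((hi _).add (hi _)) (hi _) ?_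
  filter_upwards [Lp.coeFn_inf f v, Lp.coeFn_inf f w, Lp.coeFn_inf v w, Lp.coeFn_zero ℝ 1 μ,
    (Lp.coeFn_nonneg h).2 hh] with x h1 h2 h3 h4 h5
  rw [hvw, h4] at h3
  simp only [Pi.zero_apply, Pi.inf_apply] at h1 h2 h3 h5
  simp only [indicator, posSet, mem_ofPred_eq, h1, h2, lt_inf_iff]
  by_cases k0 : 0 < f x <;> by_cases k1 : 0 < v x <;> by_cases k2 : 0 < w x <;>
    simp [k0, k1, k2, h5]
  have := lt_inf_iff.2 ⟨k1, k2⟩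
  rw [← h3] at this
  exact absurd this (lt_irrefl _)

/-- Repeated splitting yields almost invariant elements with small support. -/
theorem exists_small_support (hT : IsMarkov T) {h : Lp ℝ 1 μ} (hfix : T h = h) (hh0 : h ≠ 0)
    (hpos : ∀ᵐ x ∂μ, 0 < h x) {v w : ℕ → Lp ℝ 1 μ} (hv0 : ∀ n, 0 ≤ v n) (hw0 : ∀ n, 0 ≤ w n)
    (hvh : ∀ n, v n ≤ h) (hwh : ∀ n, w n ≤ h) (hvw : ∀ n, v n ⊓ w n = 0)
    (hvd : Tendsto (fun n => ‖v n - T (v n)‖) (hyperfilter ℕ) (𝓝 0))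
    (hwd : Tendsto (fun n => ‖w n - T (w n)‖) (hyperfilter ℕ) (𝓝 0))
    {c c' : ℝ} (hc : 0 < c) (hc' : 0 < c')
    (hv : ∀ ℓ : Lp ℝ 1 μ →L[ℝ] ℝ, Tendsto (fun n => ℓ (v n)) (hyperfilter ℕ) (𝓝 (ℓ (c • h))))
    (hw : ∀ ℓ : Lp ℝ 1 μ →L[ℝ] ℝ, Tendsto (fun n => ℓ (w n)) (hyperfilter ℕ) (𝓝 (ℓ (c' • h))))
    (k : ℕ) : ∀ ε > 0, ∃ f : Lp ℝ 1 μ, 0 ≤ f ∧ f ≤ h ∧ f ≠ 0 ∧ ‖f - T f‖ ≤ ε * ‖f‖ ∧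
      setInt μ (posSet f) h ≤ (1 / 2) ^ k * ‖h‖ := by
  have hh : 0 ≤ h := by
    rw [← Lp.coeFn_nonneg]
    exact hpos.mono fun x hx => hx.le
  induction k with
  | zero =>
    intro ε hε
    refine ⟨h, hh, le_rfl, hh0, ?_, ?_⟩
    · rw [hfix, sub_self, norm_zero]; positivity
    · rw [pow_zero, one_mul]
      exact (le_abs_self _).trans (setInt_le_norm _ _)
  | succ k ih =>
    intro ε hε
    set d := min c c' with hd
    have hd0 : 0 < d := lt_min hc hc'
    -- The tolerance must shrink at each splitting, hence the quantifier over `ε` inside the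
    -- induction. A meet has defect at most `2 (ε d / 8 + ε d / 8) ‖f‖ = ε (d / 2) ‖f‖`, and its
    -- norm is at least `(d / 2) ‖f‖`.
    obtain ⟨f, hf0, hfh, hfne, hfd, hfs⟩ := ih (ε * d / 8) (by positivity)
    have hfp : 0 < ‖f‖ := norm_pos_iff.2 hfne
    have hη : 0 < ε * d / 8 * ‖f‖ := by positivity
    obtain ⟨n, n1, n2, n3, n4⟩ := ((eventually_le_norm_inf hpos hv0 hvh hc hv hf0 hfh hfne).and
      ((eventually_le_norm_inf hpos hw0 hwh hc' hw hf0 hfh hfne).and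
      ((hvd.eventually (gt_mem_nhds hη)).and (hwd.eventually (gt_mem_nhds hη))))).exists
    have key : ∀ u : Lp ℝ 1 μ, 0 ≤ u → ∀ t : ℝ, d ≤ t → t / 2 * ‖f‖ ≤ ‖f ⊓ u‖ →
        ‖u - T u‖ < ε * d / 8 * ‖f‖ → setInt μ (posSet (f ⊓ u)) h ≤ (1 / 2) ^ (k + 1) * ‖h‖ →
        ∃ f : Lp ℝ 1 μ, 0 ≤ f ∧ f ≤ h ∧ f ≠ 0 ∧ ‖f - T f‖ ≤ ε * ‖f‖ ∧
          setInt μ (posSet f) h ≤ (1 / 2) ^ (k + 1) * ‖h‖ := by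
      intro u hu t ht h1 h2 h3
      have h4 : d / 2 * ‖f‖ ≤ ‖f ⊓ u‖ := le_trans (by gcongr) h1
      have h5 : 0 < d / 2 * ‖f‖ := by positivity
      refine ⟨f ⊓ u, le_inf hf0 hu, inf_le_left.trans hfh, norm_pos_iff.1 (h5.trans_le h4), ?_, h3⟩
      refine (hT.norm_inf_sub_le f u).trans ?_
      calc 2 * (‖f - T f‖ + ‖u - T u‖) ≤ 2 * (ε * d / 8 * ‖f‖ + ε * d / 8 * ‖f‖) := by
            gcongr
        _ = ε * (d / 2 * ‖f‖) := by ring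
        _ ≤ ε * ‖f ⊓ u‖ := by gcongr
    have hsum := setInt_posSet_inf_add_le (f := f) hh (hvw n)
    have hpow : ((1 : ℝ) / 2) ^ (k + 1) * ‖h‖ = ((1 / 2) ^ k * ‖h‖) / 2 := by ring
    rcases le_total (setInt μ (posSet (f ⊓ v n)) h) (setInt μ (posSet (f ⊓ w n)) h) with hle | hle
    · exact key (v n) (hv0 n) c (min_le_left _ _) n1 n3 (by linarith)
    · exact key (w n) (hw0 n) c' (min_le_right _ _) n2 n4 (by linarith)

/-! ### The lower bound for `1 - T` and its range. -/

/-- For an irreducible Markov operator with weak limits, `1 - T` is bounded below on the elements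
with zero integral. -/
theorem exists_bound_below (hT : IsMarkov T) (hw : HasWeakLimits T) (hirr : IsIrred T) :
    ∃ c > 0, ∀ f : Lp ℝ 1 μ, mass μ f = 0 → c * ‖f‖ ≤ ‖f - T f‖ := by
  by_contra! hcon
  -- Norm 2 and zero integral give the positive and the negative part mass 1 each.
  have hseq : ∀ n : ℕ, ∃ f : Lp ℝ 1 μ, mass μ f = 0 ∧ ‖f‖ = 2 ∧
      ‖f - T f‖ < 2 * (1 / ((n : ℝ) + 1)) := by
    intro n
    obtain ⟨f, h1, h2⟩ := hcon (1 / ((n : ℝ) + 1)) (by positivity)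
    have hne : 0 < ‖f‖ := by
      rcases (norm_nonneg f).eq_or_lt with h | h
      · rw [← h, mul_zero] at h2
        exact absurd (h2.trans_le' (norm_nonneg _)) (lt_irrefl _)
      · exact h
    refine ⟨(2 / ‖f‖) • f, by rw [map_smul, h1, smul_zero], ?_, ?_⟩
    · rw [norm_smul, Real.norm_of_nonneg (by positivity), div_mul_cancel₀ _ hne.ne']
    · rw [map_smul, ← smul_sub, norm_smul, Real.norm_of_nonneg (by positivity)]
      calc 2 / ‖f‖ * ‖f - T f‖ < 2 / ‖f‖ * (1 / ((n : ℝ) + 1) * ‖f‖) := by gcongr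
        _ = _ := by field_simp
  choose θ hθ0 hθ2 hθd using hseq
  have hlim0 : Tendsto (fun n => ‖θ n - T (θ n)‖) (hyperfilter ℕ) (𝓝 0) := by
    have h1 : Tendsto (fun n : ℕ => 2 * (1 / ((n : ℝ) + 1))) (hyperfilter ℕ) (𝓝 (2 * 0)) :=
      (tendsto_one_div_add_atTop_nhds_zero_nat.mono_left Nat.hyperfilter_le_atTop).const_mul 2
    rw [mul_zero] at h1
    exact squeeze_zero (fun _ => norm_nonneg _) (fun n => (hθd n).le) h1
  have hlim2 := hlim0.const_mul 2
  rw [mul_zero] at hlim2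
  have hm : ∀ n, mass μ (θ n)⁺ = 1 ∧ mass μ (θ n)⁻ = 1 := by
    intro n
    have h1 := hθ0 n
    have h2 := hθ2 n
    rw [norm_eq_mass_abs, ← posPart_add_negPart, map_add] at h2
    rw [← posPart_sub_negPart (θ n), map_sub] at h1
    constructor <;> linarith
  have hu1 : ∀ n, ‖(θ n)⁺‖ = 1 := fun n => by rw [norm_eq_mass (posPart_nonneg _), (hm n).1]
  have hw1 : ∀ n, ‖(θ n)⁻‖ = 1 := fun n => by rw [norm_eq_mass (negPart_nonneg _), (hm n).2]
  have hud : Tendsto (fun n => ‖(θ n)⁺ - T (θ n)⁺‖) (hyperfilter ℕ) (𝓝 0) :=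
    squeeze_zero (fun _ => norm_nonneg _) (fun n => hT.norm_posPart_sub_le (θ n)) hlim2
  have hwd : Tendsto (fun n => ‖(θ n)⁻ - T (θ n)⁻‖) (hyperfilter ℕ) (𝓝 0) := by
    refine squeeze_zero (fun _ => norm_nonneg _) (fun n => ?_) hlim2
    have h1 := hT.norm_posPart_sub_le (-θ n)
    have e2 : -θ n - T (-θ n) = -(θ n - T (θ n)) := by rw [map_neg]; abel
    rwa [posPart_neg, e2, norm_neg] at h1
  obtain ⟨h, hfix, hh⟩ := exists_weak_limit hw (fun n => (hu1 n).le) hud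
  have hh0 : 0 ≤ h := nonneg_of_weak_limit (fun n => posPart_nonneg _) hh
  have hhm : mass μ h = 1 :=
    tendsto_nhds_unique (hh (mass μ)) (tendsto_const_nhds.congr fun n => (hm n).1.symm)
  have hne : h ≠ 0 := by
    rintro rfl
    rw [map_zero] at hhm
    exact zero_ne_one hhm
  have hpos := hT.ae_pos_of_fixed hirr hh0 hfix hne
  obtain ⟨δ, hδ, H⟩ := hT.exists_pos_le_mass_inf hw hpos
  have hmeet : ∀ u : ℕ → Lp ℝ 1 μ, (∀ n, 0 ≤ u n) → (∀ n, ‖u n‖ = 1) →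
      Tendsto (fun n => ‖u n - T (u n)‖) (hyperfilter ℕ) (𝓝 0) →
      Tendsto (fun n => ‖h ⊓ u n - T (h ⊓ u n)‖) (hyperfilter ℕ) (𝓝 0) ∧
      ∃ c : ℝ, 0 < c ∧ ∀ ℓ : Lp ℝ 1 μ →L[ℝ] ℝ,
        Tendsto (fun n => ℓ (h ⊓ u n)) (hyperfilter ℕ) (𝓝 (ℓ (c • h))) := by
    intro u h1 h2 h3
    have hd : Tendsto (fun n => ‖h ⊓ u n - T (h ⊓ u n)‖) (hyperfilter ℕ) (𝓝 0) := by
      have h4 := h3.const_mul 2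
      rw [mul_zero] at h4
      refine squeeze_zero (fun _ => norm_nonneg _) (fun n => ?_) h4
      have h5 := hT.norm_inf_sub_le h (u n)
      rwa [hfix, sub_self, norm_zero, zero_add] at h5
    have h6 : ∀ n, ‖h ⊓ u n‖ ≤ 1 := fun n => by
      rw [norm_eq_mass (le_inf hh0 (h1 n)), ← h2 n, norm_eq_mass (h1 n)]
      exact mass_mono inf_le_right
    obtain ⟨g, hg, hgl⟩ := exists_weak_limit hw h6 hd
    -- Fixed elements are multiples of `h`: since `h` has mass 1, the difference is fixed with zero
    -- integral. The factor is positive because the meets with `h` do not lose all their mass.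
    have hgh : g = mass μ g • h := by
      rw [← sub_eq_zero]
      refine hT.eq_zero_of_fixed hirr ?_ ?_
      · rw [map_sub, map_smul, hg, hfix]
      · rw [map_sub, map_smul, hhm, smul_eq_mul, mul_one, sub_self]
    refine ⟨hd, mass μ g, hδ.trans_le (ge_of_tendsto (hgl (mass μ)) ?_), ?_⟩
    · filter_upwards [h3.eventually (gt_mem_nhds (show (0 : ℝ) < 1 / 8 by norm_num))] with n hn
      exact H (u n) (h1 n) (h2 n) hn.le
    · rw [← hgh]; exact hgl
  obtain ⟨hvd, c, hc, hv⟩ := hmeet _ (fun n => posPart_nonneg (θ n)) hu1 hud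
  obtain ⟨hwd', c', hc', hw'⟩ := hmeet _ (fun n => negPart_nonneg (θ n)) hw1 hwd
  have hdisj : ∀ n, (h ⊓ (θ n)⁺) ⊓ (h ⊓ (θ n)⁻) = 0 := by
    intro n
    rw [← inf_inf_distrib_left, posPart_inf_negPart_eq_zero, inf_eq_right.2 hh0]
  obtain ⟨η, hη, Hη⟩ := hT.uniform_integrability hw hpos (ε := 1 / 2) (by norm_num)
  obtain ⟨k, hk⟩ := exists_pow_lt_of_lt_one hη (show (1 / 2 : ℝ) < 1 by norm_num)
  obtain ⟨f, hf0, -, hfne, hfd, hfs⟩ := hT.exists_small_support hfix hne hpos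
    (fun n => le_inf hh0 (posPart_nonneg _)) (fun n => le_inf hh0 (negPart_nonneg _))
    (fun n => inf_le_left) (fun n => inf_le_left) hdisj hvd hwd' hc hc' hv hw' k (1 / 4)
    (by norm_num)
  have hfp : 0 < ‖f‖ := norm_pos_iff.2 hfne
  rw [norm_eq_mass hh0, hhm, mul_one] at hfs
  -- On the small support of `f`, `T f` has integral at most `‖f‖ / 2`. Almost invariance with
  -- constant `1/4` requires at least `3 ‖f‖ / 4`.
  have h1 := Hη (‖f‖⁻¹ • f) (Lp_smul_nonneg (by positivity) hf0)
    (by rw [norm_smul, norm_inv, norm_norm, inv_mul_cancel₀ hfp.ne']) (posSet f)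
    (measurableSet_posSet f) (hfs.trans hk.le)
  rw [map_smul, map_smul, smul_eq_mul, inv_mul_le_iff₀ hfp] at h1
  have h2 : setInt μ (posSet f) f = ‖f‖ := by
    have h3 := setInt_add_compl (measurableSet_posSet f) f
    have h4 : setInt μ (posSet f)ᶜ f = 0 := by
      rw [setInt_apply]
      refine integral_eq_zero_of_ae ?_
      filter_upwards [ae_restrict_of_ae ((Lp.coeFn_nonneg f).2 hf0),
        ae_restrict_mem (measurableSet_posSet f).compl] with x h5 h6
      exact le_antisymm (not_lt.1 h6) h5
    rw [norm_eq_mass hf0]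
    linarith
  have h5 := (le_abs_self _).trans (setInt_le_norm (posSet f) (f - T f))
  rw [map_sub, h2] at h5
  linarith

/-- The range of `1 - T` contains all elements with zero integral. -/
theorem exists_sub_eq (hT : IsMarkov T) (hw : HasWeakLimits T) (hirr : IsIrred T)
    {g : Lp ℝ 1 μ} (hg : mass μ g = 0) : ∃ f : Lp ℝ 1 μ, f - T f = g := by
  obtain ⟨c, hc, hbd⟩ := hT.exists_bound_below hw hirr
  -- On zero-integral `f` the Cesàro mean `A` satisfies `c ‖A f‖ ≤ ‖(1 - T) A f‖ ≤ 2 ‖f‖ / N`, so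
  -- this `N` makes it a contraction with factor `1/2`.
  obtain ⟨N, hN⟩ := exists_nat_gt (4 / c)
  have hN0 : (0 : ℝ) < N := (by positivity : (0 : ℝ) < 4 / c).trans hN
  set A : Lp ℝ 1 μ →L[ℝ] Lp ℝ 1 μ := (N : ℝ)⁻¹ • ∑ k ∈ Finset.range N, T ^ k with hA
  set Q : Lp ℝ 1 μ →L[ℝ] Lp ℝ 1 μ :=
    (N : ℝ)⁻¹ • ∑ k ∈ Finset.range N, ∑ j ∈ Finset.range k, T ^ j with hQ
  have hpow : ∀ (k : ℕ) (f : Lp ℝ 1 μ), mass μ ((T ^ k) f) = mass μ f ∧ ‖(T ^ k) f‖ ≤ ‖f‖ := by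
    intro k
    induction k with
    | zero => intro f; simp
    | succ k ih =>
      intro f
      rw [pow_succ', mul_apply_eq_comp]
      exact ⟨(hT.mass_eq _).trans (ih f).1, (hT.norm_le _).trans (ih f).2⟩
  -- Averaging `1 - T ^ k = (1 - T) (1 + ⋯ + T ^ (k-1))` over `k` shows that solving `F - A F = g`
  -- suffices, with `Q F` as the solution for `T`.
  have hAQ : 1 - A = (1 - T) * Q := by
    rw [hQ, mul_smul_comm, Finset.mul_sum]
    simp_rw [mul_neg_geom_sum]
    rw [Finset.sum_sub_distrib, smul_sub, hA, Finset.sum_const, Finset.card_range,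
      ← Nat.cast_smul_eq_nsmul ℝ, smul_smul, inv_mul_cancel₀ hN0.ne', one_smul]
  have hAd : ∀ f, ‖A f - T (A f)‖ ≤ (N : ℝ)⁻¹ * (2 * ‖f‖) := by
    intro f
    have e : (1 - T) * A = (N : ℝ)⁻¹ • (1 - T ^ N) := by
      rw [hA, mul_smul_comm, mul_neg_geom_sum]
    have e2 : A f - T (A f) = (N : ℝ)⁻¹ • (f - (T ^ N) f) := congrArg (fun S => S f) e
    rw [e2, norm_smul, Real.norm_of_nonneg (by positivity)]
    gcongr
    refine (norm_sub_le _ _).trans ?_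
    linarith [(hpow N f).2]
  have hAm : ∀ f, mass μ (A f) = mass μ f := by
    intro f
    have e : A f = (N : ℝ)⁻¹ • ∑ k ∈ Finset.range N, (T ^ k) f := by
      rw [hA, smul_apply, sum_apply]
    rw [e, map_smul, map_sum, Finset.sum_congr rfl fun k _ => (hpow k f).1, Finset.sum_const,
      Finset.card_range, nsmul_eq_mul, smul_eq_mul, inv_mul_cancel_left₀ hN0.ne']
  have hAn : ∀ f, mass μ f = 0 → ‖A f‖ ≤ 1 / 2 * ‖f‖ := by
    intro f hf
    have h1 := (hbd (A f) ((hAm f).trans hf)).trans (hAd f)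
    have h2 : 4 < N * c := by rwa [div_lt_iff₀ hc] at hN
    rw [inv_mul_eq_div, le_div_iff₀ hN0] at h1
    nlinarith [norm_nonneg (A f), norm_nonneg f]
  have hit : ∀ j : ℕ, mass μ ((A ^ j) g) = 0 ∧ ‖(A ^ j) g‖ ≤ (1 / 2) ^ j * ‖g‖ := by
    intro j
    induction j with
    | zero => simp [hg]
    | succ j ih =>
      rw [pow_succ', mul_apply_eq_comp]
      refine ⟨(hAm _).trans ih.1, (hAn _ ih.1).trans ?_⟩
      rw [pow_succ', mul_assoc]
      gcongr
      exact ih.2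
  have hsum : Summable fun j : ℕ => (A ^ j) g :=
    Summable.of_norm_bounded (summable_geometric_two.mul_right ‖g‖) fun j => (hit j).2
  set F := ∑' j : ℕ, (A ^ j) g with hF
  have hAF : F - A F = g := by
    rw [hF, A.map_tsum hsum, hsum.tsum_eq_zero_add]
    simp_rw [pow_succ', mul_apply_eq_comp]
    rw [pow_zero, one_apply_eq_self, add_sub_cancel_right]
  refine ⟨Q F, ?_⟩
  rw [← hAF]
  exact (congrArg (fun S => S F) hAQ).symm

end IsMarkov

end MarkovL1

namespace SlabTransport

open Filter Topology MarkovL1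

variable {𝕜 : Type*} [RCLike 𝕜]

/-! ### Reduction to real scalars -/

section RealParts

variable {X : Type*} [MeasurableSpace X] {μ : Measure X}

/-- The real part, as an operator on `L¹`. -/
def reL (𝕜 : Type*) [RCLike 𝕜] (μ : Measure X) : Lp 𝕜 1 μ →L[ℝ] Lp ℝ 1 μ :=
  (RCLike.reCLM (K := 𝕜)).compLpL 1 μ

/-- The imaginary part, as an operator on `L¹`. -/
def imL (𝕜 : Type*) [RCLike 𝕜] (μ : Measure X) : Lp 𝕜 1 μ →L[ℝ] Lp ℝ 1 μ :=
  (RCLike.imCLM (K := 𝕜)).compLpL 1 μ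

/-- The inclusion of real `L¹`. -/
def ofRealL (𝕜 : Type*) [RCLike 𝕜] (μ : Measure X) : Lp ℝ 1 μ →L[ℝ] Lp 𝕜 1 μ :=
  (RCLike.ofRealCLM (K := 𝕜)).compLpL 1 μ

theorem coeFn_reL (f : Lp 𝕜 1 μ) : ∀ᵐ x ∂μ, reL 𝕜 μ f x = RCLike.re (f x) :=
  ContinuousLinearMap.coeFn_compLpL _ f

theorem coeFn_imL (f : Lp 𝕜 1 μ) : ∀ᵐ x ∂μ, imL 𝕜 μ f x = RCLike.im (f x) :=
  ContinuousLinearMap.coeFn_compLpL _ f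

theorem coeFn_ofRealL (f : Lp ℝ 1 μ) : ∀ᵐ x ∂μ, ofRealL 𝕜 μ f x = (f x : 𝕜) :=
  ContinuousLinearMap.coeFn_compLpL _ f

/-- Both scalar fields are covered at once, since `RCLike.I` is zero in the real case. -/
theorem ofRealL_re_add_im (f : Lp 𝕜 1 μ) :
    ofRealL 𝕜 μ (reL 𝕜 μ f) + (RCLike.I : 𝕜) • ofRealL 𝕜 μ (imL 𝕜 μ f) = f := by
  refine Lp.ext ?_
  filter_upwards [Lp.coeFn_add (ofRealL 𝕜 μ (reL 𝕜 μ f)) ((RCLike.I : 𝕜) • ofRealL 𝕜 μ (imL 𝕜 μ f)),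
    Lp.coeFn_smul (RCLike.I : 𝕜) (ofRealL 𝕜 μ (imL 𝕜 μ f)), coeFn_ofRealL (𝕜 := 𝕜) (reL 𝕜 μ f),
    coeFn_ofRealL (𝕜 := 𝕜) (imL 𝕜 μ f), coeFn_reL f, coeFn_imL f] with x h1 h2 h3 h4 h5 h6
  rw [h1, Pi.add_apply, h2, Pi.smul_apply, h3, h4, h5, h6, smul_eq_mul, mul_comm]
  exact RCLike.re_add_im _

theorem norm_ofRealL (f : Lp ℝ 1 μ) : ‖ofRealL 𝕜 μ f‖ = ‖f‖ := by
  rw [L1.norm_eq_integral_norm, L1.norm_eq_integral_norm]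
  refine integral_congr_ae ?_
  filter_upwards [coeFn_ofRealL (𝕜 := 𝕜) f] with x hx
  rw [hx, RCLike.norm_ofReal, Real.norm_eq_abs]

theorem integral_ofRealL (f : Lp ℝ 1 μ) : ∫ x, ofRealL 𝕜 μ f x ∂μ = ((∫ x, f x ∂μ : ℝ) : 𝕜) := by
  rw [← integral_ofReal]
  exact integral_congr_ae (coeFn_ofRealL f)

theorem integral_reL (f : Lp 𝕜 1 μ) : ∫ x, reL 𝕜 μ f x ∂μ = RCLike.re (∫ x, f x ∂μ) := by
  rw [← integral_re (L1.integrable_coeFn f)]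
  exact integral_congr_ae (coeFn_reL f)

theorem integral_imL (f : Lp 𝕜 1 μ) : ∫ x, imL 𝕜 μ f x ∂μ = RCLike.im (∫ x, f x ∂μ) := by
  rw [← integral_im (L1.integrable_coeFn f)]
  exact integral_congr_ae (coeFn_imL f)

theorem ofRealL_nonneg {f : Lp ℝ 1 μ} (hf : 0 ≤ f) : ∀ᵐ x ∂μ, 0 ≤ ofRealL 𝕜 μ f x := by
  filter_upwards [coeFn_ofRealL (𝕜 := 𝕜) f, (Lp.coeFn_nonneg f).2 hf] with x h1 h2
  rw [h1]
  exact RCLike.ofReal_nonneg.2 h2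

theorem ofRealL_reL_of_nonneg {f : Lp 𝕜 1 μ} (hf : ∀ᵐ x ∂μ, 0 ≤ f x) :
    0 ≤ reL 𝕜 μ f ∧ ofRealL 𝕜 μ (reL 𝕜 μ f) = f := by
  refine ⟨?_, Lp.ext ?_⟩
  · rw [← Lp.coeFn_nonneg]
    filter_upwards [hf, coeFn_reL f] with x h1 h2
    rw [h2]
    exact (RCLike.nonneg_iff.1 h1).1
  · filter_upwards [hf, coeFn_reL f, coeFn_ofRealL (𝕜 := 𝕜) (reL 𝕜 μ f)] with x h1 h2 h3
    rw [h3, h2]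
    have h4 := RCLike.re_add_im (f x)
    rwa [(RCLike.nonneg_iff.1 h1).2, RCLike.ofReal_zero, zero_mul, add_zero] at h4

theorem ofReal_norm_of_nonneg {f : Lp 𝕜 1 μ} (hf : ∀ᵐ x ∂μ, 0 ≤ f x) :
    ((‖f‖ : ℝ) : 𝕜) = ∫ x, f x ∂μ := by
  obtain ⟨h1, h2⟩ := ofRealL_reL_of_nonneg hf
  rw [← h2, integral_ofRealL, norm_ofRealL, norm_eq_mass h1, mass_apply]

end RealParts

/-! ### Stochastic operators and their real parts. -/

section Stochastic

variable {I J H : Set ℝ}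

namespace IsStochastic

variable {T : L1 𝕜 I →L[𝕜] L1 𝕜 J}

theorem comp {S : L1 𝕜 J →L[𝕜] L1 𝕜 H} (hS : IsStochastic S) (hT : IsStochastic T) :
    IsStochastic (S ∘L T) := fun φ hφ =>
  ⟨(hS _ (hT φ hφ).1).1, (hS _ (hT φ hφ).1).2.trans (hT φ hφ).2⟩

/-- A real element is a difference of nonnegative ones, whose images are nonnegative and hence real.
-/
theorem ofRealL_reL (hT : IsStochastic T) (φ : L1 ℝ I) :
    ofRealL 𝕜 _ (reL 𝕜 _ (T (ofRealL 𝕜 _ φ))) = T (ofRealL 𝕜 _ φ) := by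
  rw [← posPart_sub_negPart φ]
  simp only [map_sub]
  rw [(ofRealL_reL_of_nonneg (hT _ (ofRealL_nonneg (posPart_nonneg φ))).1).2,
    (ofRealL_reL_of_nonneg (hT _ (ofRealL_nonneg (negPart_nonneg φ))).1).2]

theorem norm_le (hT : IsStochastic T) (φ : L1 ℝ I) : ‖T (ofRealL 𝕜 _ φ)‖ ≤ ‖φ‖ := by
  have h : ‖φ‖ = ‖φ⁺‖ + ‖φ⁻‖ := by
    rw [norm_eq_mass_abs, ← posPart_add_negPart, map_add, norm_eq_mass (posPart_nonneg φ),
      norm_eq_mass (negPart_nonneg φ)]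
  rw [h]
  nth_rewrite 1 [← posPart_sub_negPart φ]
  rw [map_sub, map_sub]
  refine (norm_sub_le _ _).trans (le_of_eq ?_)
  rw [(hT _ (ofRealL_nonneg (posPart_nonneg φ))).2, (hT _ (ofRealL_nonneg (negPart_nonneg φ))).2,
    norm_ofRealL, norm_ofRealL]

theorem integral_nonneg_eq (hT : IsStochastic T) {φ : L1 𝕜 I}
    (hφ : ∀ᵐ v ∂volume.restrict I, 0 ≤ φ v) : ∫ v in J, T φ v = ∫ v in I, φ v := by
  rw [← ofReal_norm_of_nonneg hφ, ← ofReal_norm_of_nonneg (hT φ hφ).1, (hT φ hφ).2]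

theorem integral_eq (hT : IsStochastic T) (φ : L1 𝕜 I) : ∫ v in J, T φ v = ∫ v in I, φ v := by
  have key : ∀ S : Set ℝ, ∃ ℓ : L1 𝕜 S →ₗ[𝕜] 𝕜, ∀ f, ℓ f = ∫ v in S, f v := fun S =>
    ⟨{  toFun := fun f => ∫ v in S, f v
        map_add' := fun f g => by
          rw [← integral_add (L1.integrable_coeFn f) (L1.integrable_coeFn g)]
          exact integral_congr_ae (Lp.coeFn_add f g)
        map_smul' := fun c f => by
          rw [RingHom.id_apply, ← integral_smul]
          exact integral_congr_ae (Lp.coeFn_smul c f) }, fun _ => rfl⟩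
  obtain ⟨ℓI, hI⟩ := key I
  obtain ⟨ℓJ, hJ⟩ := key J
  -- On the positive cone norm and integral agree. Linearity extends the identity to real elements
  -- and then to all of `L¹`.
  have hreal : ∀ f : L1 ℝ I, ℓJ (T (ofRealL 𝕜 _ f)) = ℓI (ofRealL 𝕜 _ f) := by
    intro f
    rw [← posPart_sub_negPart f]
    simp only [map_sub]
    rw [hJ, hJ, hI, hI, hT.integral_nonneg_eq (ofRealL_nonneg (posPart_nonneg f)),
      hT.integral_nonneg_eq (ofRealL_nonneg (negPart_nonneg f))]
  rw [← hI, ← hJ, ← ofRealL_re_add_im φ, map_add, map_add, map_add, map_smul, map_smul, map_smul,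
    hreal, hreal]

end IsStochastic

/-- The operator on real `L¹` that is induced by an operator on `L¹`. -/
def realPart (T : L1 𝕜 I →L[𝕜] L1 𝕜 J) : L1 ℝ I →L[ℝ] L1 ℝ J :=
  reL 𝕜 _ ∘L T.restrictScalars ℝ ∘L ofRealL 𝕜 _

theorem realPart_apply (T : L1 𝕜 I →L[𝕜] L1 𝕜 J) (φ : L1 ℝ I) :
    realPart T φ = reL 𝕜 _ (T (ofRealL 𝕜 _ φ)) := rfl

theorem IsStochastic.ofRealL_realPart {T : L1 𝕜 I →L[𝕜] L1 𝕜 J} (hT : IsStochastic T)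
    (φ : L1 ℝ I) : ofRealL 𝕜 _ (realPart T φ) = T (ofRealL 𝕜 _ φ) :=
  hT.ofRealL_reL φ

theorem IsStochastic.apply_eq {T : L1 𝕜 I →L[𝕜] L1 𝕜 J} (hT : IsStochastic T) (φ : L1 𝕜 I) :
    T φ = ofRealL 𝕜 _ (realPart T (reL 𝕜 _ φ)) +
      (RCLike.I : 𝕜) • ofRealL 𝕜 _ (realPart T (imL 𝕜 _ φ)) := by
  rw [hT.ofRealL_realPart, hT.ofRealL_realPart, ← map_smul, ← map_add, ofRealL_re_add_im]

theorem IsStochastic.isMarkov_realPart {G : L1 𝕜 I →L[𝕜] L1 𝕜 I} (hG : IsStochastic G) :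
    IsMarkov (realPart G) where
  nonneg f hf := (ofRealL_reL_of_nonneg (hG _ (ofRealL_nonneg hf)).1).1
  mass_eq f := by
    rw [mass_apply, mass_apply, realPart_apply, integral_reL, hG.integral_eq, integral_ofRealL,
      RCLike.ofReal_re]

/-- Weakly compact operators have weak cluster points along the hyperfilter. -/
theorem IsWeaklyCompact.exists_weak_limit {E F : Type*} [NormedAddCommGroup E] [NormedSpace 𝕜 E]
    [NormedAddCommGroup F] [NormedSpace 𝕜 F] {T : E →L[𝕜] F} (hT : IsWeaklyCompact T)
    {f : ℕ → E} (hf : ∀ n, ‖f n‖ ≤ 1) :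
    ∃ g : F, ∀ ℓ : F →L[𝕜] 𝕜, Tendsto (fun n => ℓ (T (f n))) (hyperfilter ℕ) (𝓝 (ℓ g)) := by
  obtain ⟨y, -, hy⟩ := hT.ultrafilter_le_nhds
    ((hyperfilter ℕ).map fun n => toWeakSpace 𝕜 F (T (f n))) (by
      rw [le_principal_iff]
      refine Filter.Eventually.of_forall (f := (hyperfilter ℕ : Filter ℕ)) fun n => ?_
      exact subset_closure ⟨f n, mem_closedBall_zero_iff.2 (hf n), rfl⟩)
  obtain ⟨g, rfl⟩ := (toWeakSpace 𝕜 F).surjective y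
  refine ⟨g, fun ℓ => ?_⟩
  have h1 : Tendsto (fun n => toWeakSpace 𝕜 F (T (f n))) (hyperfilter ℕ)
      (𝓝 (toWeakSpace 𝕜 F g)) := hy
  exact ((WeakBilin.eval_continuous (topDualPairing 𝕜 F).flip ℓ).tendsto _).comp h1

/-- A real functional composed with `reL` is the real part of a `𝕜`-linear functional, so weak
limits over `𝕜` pass to real parts. `O` only has to map the real unit ball into the unit ball. -/
theorem hasWeakLimits_realPart_comp {K : L1 𝕜 J →L[𝕜] L1 𝕜 I} {O : L1 𝕜 I →L[𝕜] L1 𝕜 J}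
    (hO : IsStochastic O) (hK : IsWeaklyCompact K) : HasWeakLimits (realPart (K ∘L O)) := by
  intro f hf
  obtain ⟨g, hg⟩ := hK.exists_weak_limit (f := fun n => O (ofRealL 𝕜 _ (f n)))
    fun n => (hO.norm_le (f n)).trans (hf n)
  refine ⟨reL 𝕜 _ g, fun ℓ => ?_⟩
  have h1 := (RCLike.continuous_re.tendsto _).comp
    (hg (StrongDual.extendRCLike (𝕜 := 𝕜) (ℓ ∘L reL 𝕜 _)))
  have e : ∀ u : L1 𝕜 I, RCLike.re (StrongDual.extendRCLike (𝕜 := 𝕜) (ℓ ∘L reL 𝕜 _) u) =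
      ℓ (reL 𝕜 _ u) := fun u => by
    rw [StrongDual.extendRCLike_apply]
    simp
  rw [e] at h1
  exact h1.congr fun n => e _

/-- A stochastic operator acts separately on real and imaginary parts, so an ideal invariant under
the real part of `G` yields one invariant under `G`. -/
theorem IsIrreducibleOperator.isIrred_realPart {G : L1 𝕜 I →L[𝕜] L1 𝕜 I} (hI : MeasurableSet I)
    (hG : IsStochastic G) (hirr : IsIrreducibleOperator G) : IsIrred (realPart G) := by
  intro A hA hinv
  have hset : Aᶜ ∩ I = I \ (A ∩ I) := by
    ext x; simp only [mem_inter_iff, mem_compl_iff, Set.mem_sdiff]; tauto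
  rw [Measure.restrict_restrict hA.compl, hset] at hinv
  rw [Measure.restrict_apply hA, Measure.restrict_apply hA.compl, hset]
  refine hirr (A ∩ I) inter_subset_right (hA.inter hI) fun φ hφ => ?_
  have hr : ∀ {p : ℝ → Prop}, (∀ᵐ v ∂volume.restrict I, p v) →
      ∀ᵐ v ∂volume.restrict (I \ (A ∩ I)), p v := fun h =>
    ae_mono (Measure.restrict_mono sdiff_subset le_rfl) h
  have h1 := hinv (reL 𝕜 _ φ) (by
    filter_upwards [hφ, hr (coeFn_reL φ)] with v h2 h3
    rw [h3, h2, map_zero])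
  have h2 := hinv (imL 𝕜 _ φ) (by
    filter_upwards [hφ, hr (coeFn_imL φ)] with v h2 h3
    rw [h3, h2, map_zero])
  rw [hG.apply_eq]
  filter_upwards [h1, h2, hr (Lp.coeFn_add (ofRealL 𝕜 _ (realPart G (reL 𝕜 _ φ)))
      ((RCLike.I : 𝕜) • ofRealL 𝕜 _ (realPart G (imL 𝕜 _ φ)))),
    hr (Lp.coeFn_smul (RCLike.I : 𝕜) (ofRealL 𝕜 _ (realPart G (imL 𝕜 _ φ)))),
    hr (coeFn_ofRealL (𝕜 := 𝕜) (realPart G (reL 𝕜 _ φ))),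
    hr (coeFn_ofRealL (𝕜 := 𝕜) (realPart G (imL 𝕜 _ φ)))] with v k1 k2 k3 k4 k5 k6
  rw [k3, Pi.add_apply, k4, Pi.smul_apply, k5, k6, k1, k2]
  simp

/-- The range of `1 - K O` contains all elements with zero integral, if `K` is weakly compact and
`K O` is irreducible. -/
theorem exists_sub_eq_of_irreducible {K : L1 𝕜 J →L[𝕜] L1 𝕜 I} {O : L1 𝕜 I →L[𝕜] L1 𝕜 J}
    (hI : MeasurableSet I) (hK : IsStochastic K) (hO : IsStochastic O) (hKc : IsWeaklyCompact K)
    (hirr : IsIrreducibleOperator (K ∘L O)) {ψ : L1 𝕜 I} (hψ : ∫ v in I, ψ v = 0) :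
    ∃ φ : L1 𝕜 I, φ - K (O φ) = ψ := by
  have hG := hK.comp hO
  have hM := hG.isMarkov_realPart
  have hw := hasWeakLimits_realPart_comp hO hKc
  have hi := hirr.isIrred_realPart hI hG
  obtain ⟨r, hr⟩ := hM.exists_sub_eq hw hi (g := reL 𝕜 _ ψ) (by
    rw [mass_apply, integral_reL, hψ, map_zero])
  obtain ⟨s, hs⟩ := hM.exists_sub_eq hw hi (g := imL 𝕜 _ ψ) (by
    rw [mass_apply, integral_imL, hψ, map_zero])
  refine ⟨ofRealL 𝕜 _ r + (RCLike.I : 𝕜) • ofRealL 𝕜 _ s, ?_⟩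
  have e : ∀ φ, K (O φ) = (K ∘L O) φ := fun φ => rfl
  rw [e, map_add, map_smul, ← hG.ofRealL_realPart, ← hG.ofRealL_realPart, add_sub_add_comm,
    ← smul_sub, ← map_sub, ← map_sub, hr, hs, ofRealL_re_add_im]

/-! ### The boundary operators -/

theorem isStochastic_convexComb {R K : L1 𝕜 I →L[𝕜] L1 𝕜 J} {α β : ℝ} (hα : 0 ≤ α) (hβ : 0 ≤ β)
    (h : α + β = 1) (hR : IsStochastic R) (hK : IsStochastic K) :
    IsStochastic ((α : 𝕜) • R + (β : 𝕜) • K) := by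
  intro φ hφ
  have hae : ∀ᵐ v ∂volume.restrict J, (((α : 𝕜) • R + (β : 𝕜) • K) φ) v =
      (α : 𝕜) * R φ v + (β : 𝕜) * K φ v := by
    filter_upwards [Lp.coeFn_add ((α : 𝕜) • R φ) ((β : 𝕜) • K φ), Lp.coeFn_smul (α : 𝕜) (R φ),
      Lp.coeFn_smul (β : 𝕜) (K φ)] with v h1 h2 h3
    change (((α : 𝕜) • R φ + (β : 𝕜) • K φ : L1 𝕜 J) : ℝ → 𝕜) v = _
    rw [h1, Pi.add_apply, h2, h3]
    rfl
  have hpos : ∀ᵐ v ∂volume.restrict J, 0 ≤ (((α : 𝕜) • R + (β : 𝕜) • K) φ) v := by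
    filter_upwards [hae, (hR φ hφ).1, (hK φ hφ).1] with v h1 h2 h3
    rw [h1]
    exact add_nonneg (mul_nonneg (RCLike.ofReal_nonneg.2 hα) h2)
      (mul_nonneg (RCLike.ofReal_nonneg.2 hβ) h3)
  refine ⟨hpos, ?_⟩
  rw [← RCLike.ofReal_inj (K := 𝕜), ofReal_norm_of_nonneg hpos, ofReal_norm_of_nonneg hφ,
    integral_congr_ae hae, integral_add ((L1.integrable_coeFn _).const_mul _)
      ((L1.integrable_coeFn _).const_mul _), integral_const_mul, integral_const_mul,
    hR.integral_nonneg_eq hφ, hK.integral_nonneg_eq hφ, ← add_mul, ← RCLike.ofReal_add, h,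
    RCLike.ofReal_one, one_mul]

end Stochastic

theorem coeFn_reflectLeft (φ : L1 𝕜 negVel) :
    ∀ᵐ v ∂volume.restrict posVel, reflectLeft 𝕜 φ v = φ (-v) :=
  Lp.coeFn_compMeasurePreserving φ measurePreserving_neg_posVel

theorem coeFn_reflectRight (φ : L1 𝕜 posVel) :
    ∀ᵐ v ∂volume.restrict negVel, reflectRight 𝕜 φ v = φ (-v) :=
  Lp.coeFn_compMeasurePreserving φ measurePreserving_neg_negVel

theorem isStochastic_reflectLeft : IsStochastic (reflectLeft 𝕜) := by
  refine fun φ hφ => ⟨?_, LinearIsometry.norm_map _ _⟩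
  filter_upwards [coeFn_reflectLeft φ,
    measurePreserving_neg_posVel.quasiMeasurePreserving.ae hφ] with v h1 h2
  rw [h1]; exact h2

theorem isStochastic_reflectRight : IsStochastic (reflectRight 𝕜) := by
  refine fun φ hφ => ⟨?_, LinearIsometry.norm_map _ _⟩
  filter_upwards [coeFn_reflectRight φ,
    measurePreserving_neg_negVel.quasiMeasurePreserving.ae hφ] with v h1 h2
  rw [h1]; exact h2

/-! ### The weight `|v|⁻¹` and the boundary equations. -/

/-- `|v|⁻¹ φ` is integrable. -/
def InvWeightIntegrable {I : Set ℝ} (φ : L1 𝕜 I) : Prop :=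
  IntegrableOn (fun v => |v|⁻¹ • φ v) I

theorem InvWeightBounded.integrable {I J : Set ℝ} {T : L1 𝕜 I →L[𝕜] L1 𝕜 J}
    (hT : InvWeightBounded T) (φ : L1 𝕜 I) : InvWeightIntegrable (T φ) := by
  obtain ⟨B, hB⟩ := hT
  exact (L1.integrable_coeFn (B φ)).congr (hB φ)

/-- The conjugated operator is applied to `|v|⁻¹ ψ`, whose product with `|v|` is `ψ` almost
everywhere. -/
theorem WeightConjBounded.integrable {I J : Set ℝ} {T : L1 𝕜 I →L[𝕜] L1 𝕜 J}
    (hI : ∀ᵐ v ∂volume.restrict I, v ≠ 0)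
    (hT : WeightConjBounded T) {ψ : L1 𝕜 I} (hψ : InvWeightIntegrable ψ) :
    InvWeightIntegrable (T ψ) := by
  obtain ⟨B, hB⟩ := hT
  refine (L1.integrable_coeFn (B (hψ.toL1 _))).congr (hB _ ψ ?_)
  filter_upwards [hI, hψ.coeFn_toL1] with v h1 h2
  rw [h2, smul_smul, mul_inv_cancel₀ (abs_ne_zero.2 h1), one_smul]

theorem InvWeightIntegrable.convexComb {I J : Set ℝ} {R K : L1 𝕜 I →L[𝕜] L1 𝕜 J} {φ : L1 𝕜 I}
    (hR : InvWeightIntegrable (R φ)) (hK : InvWeightIntegrable (K φ)) (α β : 𝕜) :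
    InvWeightIntegrable ((α • R + β • K) φ) := by
  refine ((hR.smul α).add (hK.smul β)).congr ?_
  filter_upwards [Lp.coeFn_add (α • R φ) (β • K φ), Lp.coeFn_smul α (R φ),
    Lp.coeFn_smul β (K φ)] with v h1 h2 h3
  change _ = |v|⁻¹ • ((α • R φ + β • K φ : L1 𝕜 J) : ℝ → 𝕜) v
  rw [h1]
  simp only [Pi.add_apply, h2, h3, Pi.smul_apply, smul_add, smul_comm α, smul_comm β]

theorem InvWeightIntegrable.reflectLeft {φ : L1 𝕜 negVel} (hφ : InvWeightIntegrable φ) :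
    InvWeightIntegrable (reflectLeft 𝕜 φ) := by
  have h := measurePreserving_neg_posVel.integrable_comp_of_integrable hφ
  refine h.congr ?_
  filter_upwards [coeFn_reflectLeft φ] with v h1
  rw [h1, Function.comp_apply, abs_neg]

theorem InvWeightIntegrable.reflectRight {φ : L1 𝕜 posVel} (hφ : InvWeightIntegrable φ) :
    InvWeightIntegrable (reflectRight 𝕜 φ) := by
  have h := measurePreserving_neg_negVel.integrable_comp_of_integrable hφ
  refine h.congr ?_
  filter_upwards [coeFn_reflectRight φ] with v h1
  rw [h1, Function.comp_apply, abs_neg]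

theorem InvWeightIntegrable.sub {I : Set ℝ} {φ ψ : L1 𝕜 I} (hφ : InvWeightIntegrable φ)
    (hψ : InvWeightIntegrable ψ) : InvWeightIntegrable (φ - ψ) := by
  refine (Integrable.sub hφ hψ).congr ?_
  filter_upwards [Lp.coeFn_sub φ ψ] with v h
  simp only [h, Pi.sub_apply, smul_sub]

/-- The system of boundary equations, when one of the boundary operators is weakly compact and has
values in a weighted space. -/
theorem exists_boundary_values {I J : Set ℝ} (hI : MeasurableSet I)
    {K : L1 𝕜 J →L[𝕜] L1 𝕜 I} {O : L1 𝕜 I →L[𝕜] L1 𝕜 J}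
    (hK : IsStochastic K) (hO : IsStochastic O) (hKc : IsWeaklyCompact K)
    (hirr : IsIrreducibleOperator (K ∘L O)) (hKw : InvWeightBounded K)
    (hOw : ∀ φ, InvWeightIntegrable φ → InvWeightIntegrable (O φ))
    {GI : L1 𝕜 I} {GJ : L1 𝕜 J} (hGI : InvWeightIntegrable GI)
    (hG : (∫ v in I, GI v) + ∫ v in J, GJ v = 0) :
    ∃ (p : L1 𝕜 I) (q : L1 𝕜 J), InvWeightIntegrable p ∧ InvWeightIntegrable q ∧
      p = K (q - GJ) ∧ q = O (p - GI) := by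
  -- This right side comes from substituting `q = O (p - GI)` into `p = K (q - GJ)`. Its integral is
  -- minus the sum in `hG`.
  obtain ⟨p, hp⟩ := exists_sub_eq_of_irreducible hI hK hO hKc hirr (ψ := -K (O GI + GJ)) (by
    have e : ∫ v in I, (-K (O GI + GJ) : L1 𝕜 I) v = -∫ v in I, K (O GI + GJ) v := by
      rw [← integral_neg]
      exact integral_congr_ae (Lp.coeFn_neg _)
    have e2 : ∫ v in J, (O GI + GJ : L1 𝕜 J) v = (∫ v in J, O GI v) + ∫ v in J, GJ v := by
      rw [← integral_add (L1.integrable_coeFn _) (L1.integrable_coeFn _)]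
      exact integral_congr_ae (Lp.coeFn_add _ _)
    rw [e, hK.integral_eq, e2, hO.integral_eq, hG, neg_zero])
  have hpq : p = K (O (p - GI) - GJ) := by
    rw [map_sub, map_sub, map_sub]
    rw [map_add] at hp
    rw [sub_eq_iff_eq_add] at hp
    nth_rewrite 1 [hp]
    abel
  have hpw : InvWeightIntegrable p := by
    rw [hpq]
    exact hKw.integrable _
  exact ⟨p, O (p - GI), hpw, hOw _ (hpw.sub hGI), hpq, rfl⟩

/-! ### Integration along the characteristics -/

theorem restrict_phaseSpace (a : ℝ) : (volume.restrict (phaseSpace a) : Measure (ℝ × ℝ)) =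
    (volume.restrict (Ioo (-a) a)).prod (volume.restrict (Ioo (-1) 1)) := by
  rw [phaseSpace, Measure.volume_eq_prod, Measure.prod_restrict]

theorem integrableOn_integral_slice {a : ℝ} {u : ℝ × ℝ → 𝕜} (hu : IntegrableOn u (phaseSpace a)) :
    IntegrableOn (fun v => ∫ s in Ioo (-a) a, u (s, v)) (Ioo (-1) 1) := by
  rw [IntegrableOn, restrict_phaseSpace] at hu
  exact hu.integral_prod_right

theorem integral_phaseSpace {a : ℝ} {u : ℝ × ℝ → 𝕜} (hu : IntegrableOn u (phaseSpace a)) :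
    ∫ z in phaseSpace a, u z = ∫ v in Ioo (-1) 1, ∫ s in Ioo (-a) a, u (s, v) := by
  rw [IntegrableOn, restrict_phaseSpace] at hu
  rw [restrict_phaseSpace]
  exact integral_prod_symm _ hu

/-- The integral of `g(·, v)` over `(-a, x)`. -/
def primitive (a : ℝ) (g : ℝ × ℝ → 𝕜) (z : ℝ × ℝ) : 𝕜 :=
  ∫ s in Ioo (-a) a, if s < z.1 then g (s, z.2) else 0

/-- Writing the primitive as an integral over a fixed interval with the cutoff `s < x` gives joint
measurability in `(x, v)`. -/
theorem stronglyMeasurable_primitive (a : ℝ) {g : ℝ × ℝ → 𝕜} (hg : StronglyMeasurable g) :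
    StronglyMeasurable (primitive a g) := by
  have h : StronglyMeasurable fun y : (ℝ × ℝ) × ℝ => if y.2 < y.1.1 then g (y.2, y.1.2) else 0 :=
    StronglyMeasurable.ite (measurableSet_lt measurable_snd (measurable_fst.comp measurable_fst))
      (hg.comp_measurable (measurable_snd.prodMk (measurable_snd.comp measurable_fst)))
      stronglyMeasurable_const
  exact h.integral_prod_right'

theorem primitive_right (a : ℝ) (g : ℝ × ℝ → 𝕜) (v : ℝ) :
    primitive a g (a, v) = ∫ s in Ioo (-a) a, g (s, v) :=
  setIntegral_congr_fun measurableSet_Ioo fun _ hs => if_pos hs.2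

theorem norm_primitive_le (a : ℝ) (g : ℝ × ℝ → 𝕜) (x : ℝ) {v : ℝ}
    (hg : IntegrableOn (fun s => g (s, v)) (Ioo (-a) a)) :
    ‖primitive a g (x, v)‖ ≤ ∫ s in Ioo (-a) a, ‖g (s, v)‖ := by
  refine norm_integral_le_of_norm_le hg.norm (Filter.Eventually.of_forall fun s => ?_)
  dsimp only
  split_ifs
  · exact le_rfl
  · rw [norm_zero]; exact norm_nonneg _

/-- Integration by parts against a primitive. -/
theorem integral_deriv_smul_primitive {a : ℝ} {ψ ψ' : ℝ → ℝ}
    (hψ : ∀ x, HasDerivAt ψ (ψ' x) x) (hψ' : Continuous ψ') {C : ℝ} (hC : ∀ x, ‖ψ' x‖ ≤ C)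
    {u : ℝ → 𝕜} (hu : IntegrableOn u (Ioo (-a) a)) :
    ∫ x in Ioo (-a) a, ψ' x • ∫ s in Ioo (-a) a, (if s < x then u s else 0) =
      ∫ s in Ioo (-a) a, (ψ a - ψ s) • u s := by
  set P : Measure ℝ := volume.restrict (Ioo (-a) a) with hP
  -- Fubini on the triangle `s < x` replaces differentiation of the primitive, which is only
  -- absolutely continuous. The inner integral over `(s, a)` is then `ψ a - ψ s`.
  set k : ℝ × ℝ → ℝ := fun y => if y.2 < y.1 then ψ' y.1 else 0 with hk
  have hkm : Measurable k := Measurable.ite (measurableSet_lt measurable_snd measurable_fst)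
    (hψ'.measurable.comp measurable_fst) measurable_const
  have hkC : ∀ y, ‖k y‖ ≤ C := fun y => by
    rw [hk]
    dsimp only
    split_ifs
    · exact hC _
    · rw [norm_zero]; exact (norm_nonneg _).trans (hC 0)
  have hint : Integrable (fun y : ℝ × ℝ => k y • u y.2) (P.prod P) :=
    Integrable.bdd_smul (hu.comp_snd P) C hkm.aestronglyMeasurable (Filter.Eventually.of_forall hkC)
  calc ∫ x, ψ' x • ∫ s, (if s < x then u s else 0) ∂P ∂P
      = ∫ x, ∫ s, k (x, s) • u s ∂P ∂P := by
        refine integral_congr_ae (Filter.Eventually.of_forall fun x => ?_)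
        dsimp only
        rw [← integral_smul]
        refine integral_congr_ae (Filter.Eventually.of_forall fun s => ?_)
        simp only [hk]
        split_ifs <;> simp
    _ = ∫ s, ∫ x, k (x, s) • u s ∂P ∂P := integral_integral_swap hint
    _ = ∫ s, (ψ a - ψ s) • u s ∂P := by
        refine setIntegral_congr_fun measurableSet_Ioo fun s hs => ?_
        rw [integral_smul_const]
        congr 1
        have e1 : ∀ x, k (x, s) = (Ioi s).indicator ψ' x := fun x => by
          simp only [hk, indicator, mem_Ioi]
        simp_rw [e1]
        rw [integral_indicator measurableSet_Ioi, hP, Measure.restrict_restrict measurableSet_Ioi,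
          inter_comm, Ioo_inter_Ioi, max_eq_right hs.1.le, ← integral_Ioc_eq_integral_Ioo,
          ← intervalIntegral.integral_of_le hs.2.le]
        exact intervalIntegral.integral_eq_sub_of_hasDerivAt (fun x _ => hψ x)
          (hψ'.intervalIntegrable _ _)

variable {a : ℝ}

theorem hasDerivAt_dx {φ : ℝ × ℝ → ℝ} (h : ContDiff ℝ ∞ φ) (x v : ℝ) :
    HasDerivAt (fun x => φ (x, v)) (dx φ (x, v)) x := by
  have h1 := (h.differentiable (by simp) (x, v)).hasFDerivAt
  have h2 : HasDerivAt (fun x : ℝ => (x, v)) (1, 0) x :=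
    (hasDerivAt_id x).prodMk (hasDerivAt_const x v)
  exact h1.comp_hasDerivAt x h2

theorem continuous_dx {φ : ℝ × ℝ → ℝ} (h : ContDiff ℝ ∞ φ) : Continuous (dx φ) :=
  (h.continuous_fderiv (by simp)).clm_apply continuous_const

theorem exists_bound_dx {φ : ℝ × ℝ → ℝ} (h : ContDiff ℝ ∞ φ) (h2 : HasCompactSupport φ) :
    ∃ C, ∀ z, ‖dx φ z‖ ≤ C := by
  have hs : HasCompactSupport (dx φ) :=
    (h2.fderiv (𝕜 := ℝ)).comp_left (g := fun L : ℝ × ℝ →L[ℝ] ℝ => L (1, 0)) (by simp)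
  exact hs.exists_bound_of_continuous (continuous_dx h)

/-- The solution of `v ∂f/∂x = -g` with `v f(-a, v) = m(v)`. -/
def characteristicSolution (a : ℝ) (g : ℝ × ℝ → 𝕜) (m : ℝ → 𝕜) (z : ℝ × ℝ) : 𝕜 :=
  z.2⁻¹ • (m z.2 - primitive a g z)

/-- The bound `|v|⁻¹ (‖m(v)‖ + ∫ ‖g(s,v)‖ ds)` does not depend on `x`, and both of its terms are
integrable by the weighted hypotheses. -/
theorem integrable_characteristicSolution {g : ℝ × ℝ → 𝕜} (hgm : StronglyMeasurable g)
    (hg : IntegrableOn g (phaseSpace a))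
    (hgw : IntegrableOn (fun z : ℝ × ℝ => |z.2|⁻¹ • g z) (phaseSpace a)) {m : ℝ → 𝕜}
    (hmm : StronglyMeasurable m) (hmw : IntegrableOn (fun v => |v|⁻¹ • m v) (Ioo (-1) 1)) :
    IntegrableOn (characteristicSolution a g m) (phaseSpace a) := by
  rw [IntegrableOn, restrict_phaseSpace] at hg hgw ⊢
  have h1 : Integrable (fun v => |v|⁻¹ * ∫ s in Ioo (-a) a, ‖g (s, v)‖)
      (volume.restrict (Ioo (-1 : ℝ) 1)) := by
    refine hgw.norm.integral_prod_right.congr (Filter.Eventually.of_forall fun v => ?_)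
    dsimp only
    rw [← integral_const_mul]
    refine integral_congr_ae (Filter.Eventually.of_forall fun s => ?_)
    dsimp only
    rw [norm_smul, norm_inv, Real.norm_eq_abs, abs_abs]
  have h2 := (hmw.norm.add h1).comp_snd (volume.restrict (Ioo (-a) a))
  refine h2.mono' (StronglyMeasurable.aestronglyMeasurable ?_) ?_
  · exact measurable_snd.inv.stronglyMeasurable.smul
      ((hmm.comp_measurable measurable_snd).sub (stronglyMeasurable_primitive a hgm))
  · have h3 : ∀ᵐ z ∂(volume.restrict (Ioo (-a) a)).prod (volume.restrict (Ioo (-1 : ℝ) 1)),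
        IntegrableOn (fun s => g (s, z.2)) (Ioo (-a) a) :=
      Measure.quasiMeasurePreserving_snd.ae hg.prod_left_ae
    filter_upwards [h3] with z hz
    rw [characteristicSolution, norm_smul, Pi.add_apply, norm_smul, norm_inv, norm_inv,
      Real.norm_eq_abs, Real.norm_eq_abs, abs_abs, ← mul_add]
    gcongr
    exact (norm_sub_le _ _).trans (add_le_add le_rfl (norm_primitive_le a g z.1 hz))

/-- The Green formula for the solution along the characteristics. -/
theorem green_characteristicSolution (ha : 0 < a) {g : ℝ × ℝ → 𝕜} (hgm : StronglyMeasurable g)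
    (hg : IntegrableOn g (phaseSpace a))
    (hgw : IntegrableOn (fun z : ℝ × ℝ => |z.2|⁻¹ • g z) (phaseSpace a)) {m : ℝ → 𝕜}
    (hmm : StronglyMeasurable m) (hm : IntegrableOn m (Ioo (-1) 1))
    (hmw : IntegrableOn (fun v => |v|⁻¹ • m v) (Ioo (-1) 1)) {φ : ℝ × ℝ → ℝ}
    (h1 : ContDiff ℝ ∞ φ) (h2 : HasCompactSupport φ) :
    -(∫ z in phaseSpace a, φ z • g z) +
        ∫ z in phaseSpace a, (z.2 * dx φ z) • characteristicSolution a g m z =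
      (∫ v in Ioo (-1) 1, φ (a, v) • (m v - primitive a g (a, v))) -
        ∫ v in Ioo (-1) 1, φ (-a, v) • m v := by
  have hf := integrable_characteristicSolution hgm hg hgw hmm hmw
  obtain ⟨C, hC⟩ := h2.exists_bound_of_continuous h1.continuous
  obtain ⟨D, hD⟩ := exists_bound_dx h1 h2
  have i1 : IntegrableOn (fun z => φ z • g z) (phaseSpace a) :=
    integrable_smul h1.continuous hC hg
  have hvd : HasCompactSupport (fun z : ℝ × ℝ => z.2 * dx φ z) := by
    refine HasCompactSupport.mul_left (f := fun z : ℝ × ℝ => z.2) ?_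
    exact (h2.fderiv (𝕜 := ℝ)).comp_left (g := fun L : ℝ × ℝ →L[ℝ] ℝ => L (1, 0)) (by simp)
  have hvc : Continuous (fun z : ℝ × ℝ => z.2 * dx φ z) := continuous_snd.mul (continuous_dx h1)
  obtain ⟨E, hE⟩ := hvd.exists_bound_of_continuous hvc
  have i2 : IntegrableOn (fun z => (z.2 * dx φ z) • characteristicSolution a g m z)
      (phaseSpace a) := integrable_smul hvc hE hf
  have hgs : ∀ᵐ v ∂volume.restrict (Ioo (-1 : ℝ) 1),
      IntegrableOn (fun s => g (s, v)) (Ioo (-a) a) := by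
    rw [IntegrableOn, restrict_phaseSpace] at hg
    exact hg.prod_left_ae
  have hprim : IntegrableOn (fun v => primitive a g (a, v)) (Ioo (-1) 1) := by
    simp_rw [primitive_right]
    exact integrableOn_integral_slice hg
  have j1 : ∀ x : ℝ, Continuous fun v => φ (x, v) := fun x => h1.continuous.comp (by fun_prop)
  rw [neg_add_eq_sub, ← integral_sub i2 i1, ← integral_sub
    (integrable_smul (u := fun v => m v - primitive a g (a, v)) (j1 a) (fun v => hC (a, v))
      (hm.sub hprim))
    (integrable_smul (j1 (-a)) (fun v => hC (-a, v)) hm)]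
  -- By Fubini the formula reduces to a one-dimensional identity for almost every `v ≠ 0`, where the
  -- factor `v` cancels the `v⁻¹` in the solution.
  refine (integral_phaseSpace (i2.sub i1)).trans (integral_congr_ae ?_)
  have hv0 : ∀ᵐ v ∂volume.restrict (Ioo (-1 : ℝ) 1), v ≠ 0 :=
    ae_restrict_of_ae (Measure.ae_ne volume 0)
  filter_upwards [hgs, hv0] with v hv hv0
  have hder : ∀ x, HasDerivAt (fun x => φ (x, v)) (dx φ (x, v)) x := fun x =>
    hasDerivAt_dx h1 x v
  have hdc : Continuous fun x => dx φ (x, v) := (continuous_dx h1).comp (by fun_prop)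
  have hbyparts := integral_deriv_smul_primitive hder hdc (fun x => hD (x, v)) hv
  have hftc : ∫ x in Ioo (-a) a, dx φ (x, v) = φ (a, v) - φ (-a, v) := by
    rw [← integral_Ioc_eq_integral_Ioo, ← intervalIntegral.integral_of_le (by linarith)]
    exact intervalIntegral.integral_eq_sub_of_hasDerivAt (fun x _ => hder x)
      (hdc.intervalIntegrable _ _)
  have k1 : IntegrableOn (fun x => dx φ (x, v) • m v) (Ioo (-a) a) :=
    integrable_smul hdc (fun x => hD (x, v)) (integrable_const _)
  have k2 : IntegrableOn (fun x => dx φ (x, v) • primitive a g (x, v)) (Ioo (-a) a) := by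
    refine integrable_smul hdc (fun x => hD (x, v)) ?_
    refine Integrable.mono' (integrable_const (∫ s in Ioo (-a) a, ‖g (s, v)‖))
      ((stronglyMeasurable_primitive a hgm).comp_measurable
        (measurable_id.prodMk measurable_const)).aestronglyMeasurable
      (Filter.Eventually.of_forall fun x => norm_primitive_le a g x hv)
  have hφc : Continuous fun x => φ (x, v) := h1.continuous.comp (by fun_prop)
  have k3 : IntegrableOn (fun x => φ (x, v) • g (x, v)) (Ioo (-a) a) :=
    integrable_smul hφc (fun x => hC (x, v)) hv
  have k4 : IntegrableOn (fun x => φ (a, v) • g (x, v)) (Ioo (-a) a) := hv.smul (φ (a, v))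
  have e1 : ∀ x, (v * dx φ (x, v)) • characteristicSolution a g m (x, v) - φ (x, v) • g (x, v) =
      dx φ (x, v) • m v - dx φ (x, v) • primitive a g (x, v) - φ (x, v) • g (x, v) := by
    intro x
    rw [characteristicSolution, smul_smul, mul_comm v, mul_assoc, mul_inv_cancel₀ hv0, mul_one,
      smul_sub]
  refine (integral_congr_ae (Filter.Eventually.of_forall e1)).trans ?_
  have k5 : IntegrableOn (fun x => dx φ (x, v) • m v - dx φ (x, v) • primitive a g (x, v))
      (Ioo (-a) a) := k1.sub k2
  rw [integral_sub k5 k3, integral_sub k1 k2, integral_smul_const, hftc,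
    show ∫ x in Ioo (-a) a, dx φ (x, v) • primitive a g (x, v) = _ from hbyparts]
  simp_rw [sub_smul]
  rw [integral_sub k4 k3, integral_smul, smul_sub, primitive_right]
  abel

/-! ### The range of the transport operator -/

theorem ae_restrict_ne_zero {I : Set ℝ} : ∀ᵐ v ∂volume.restrict I, v ≠ 0 :=
  ae_restrict_of_ae (Measure.ae_ne volume 0)

theorem integrableOn_Ioo_of_neg_pos {E : Type*} [NormedAddCommGroup E] {u : ℝ → E}
    (h1 : IntegrableOn u negVel) (h2 : IntegrableOn u posVel) : IntegrableOn u (Ioo (-1) 1) := by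
  rw [← Ioc_union_Ioo_eq_Ioo (show (-1 : ℝ) ≤ 0 by norm_num) (show (0 : ℝ) < 1 by norm_num)]
  exact ((integrableOn_Ioc_iff_integrableOn_Ioo (by simp)).2 h1).union h2

theorem posVel_subset : posVel ⊆ Ioo (-1) 1 := Ioo_subset_Ioo_left (by norm_num)

theorem negVel_subset : negVel ⊆ Ioo (-1) 1 := Ioo_subset_Ioo_right (by norm_num)

/-- If the outgoing fluxes `p` at `x = -a` and `q` at `x = a` solve the boundary equations, then the
solution along the characteristics is in the domain, and `g` is in the range. -/
theorem mem_range_of_boundary_values (ha : 0 < a)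
    {O₁ : L1 𝕜 negVel →L[𝕜] L1 𝕜 posVel} {O₂ : L1 𝕜 posVel →L[𝕜] L1 𝕜 negVel}
    {g : L1 𝕜 (phaseSpace a)}
    (hgw : IntegrableOn (fun z : ℝ × ℝ => |z.2|⁻¹ • g z) (phaseSpace a))
    {p Gp : L1 𝕜 posVel} {q Gn : L1 𝕜 negVel}
    (hGp : ∀ᵐ v ∂volume.restrict posVel, Gp v = ∫ s in Ioo (-a) a, g (s, v))
    (hGn : ∀ᵐ v ∂volume.restrict negVel, Gn v = ∫ s in Ioo (-a) a, g (s, v))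
    (hp : InvWeightIntegrable p) (hq : InvWeightIntegrable q) (hGnw : InvWeightIntegrable Gn)
    (hpe : p = O₁ (q - Gn)) (hqe : q = O₂ (p - Gp)) :
    g ∈ LinearMap.range (transportOperator a O₁ O₂).toFun := by
  have hgm : StronglyMeasurable g := Lp.stronglyMeasurable g
  have hgi : IntegrableOn g (phaseSpace a) := L1.integrable_coeFn g
  set r : L1 𝕜 negVel := q - Gn with hr
  -- `m` stands for `v f(-a, v)`, and `r` for the flux `h_{-a}^-`. The minus sign is that of `v =
  -- -|v|` for left-moving particles.
  set m : ℝ → 𝕜 := fun v => if 0 < v then p v else -r v with hm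
  have hmm : StronglyMeasurable m := StronglyMeasurable.ite measurableSet_Ioi
    (Lp.stronglyMeasurable p) (Lp.stronglyMeasurable r).neg
  have hmp : ∀ v ∈ posVel, m v = p v := fun v hv => if_pos hv.1
  have hmn : ∀ v ∈ negVel, m v = -r v := fun v hv => if_neg (not_lt.2 hv.2.le)
  have hmi : IntegrableOn m (Ioo (-1) 1) := by
    refine integrableOn_Ioo_of_neg_pos ?_ ?_
    · exact (L1.integrable_coeFn r).neg.congr
        ((ae_restrict_mem measurableSet_Ioo).mono fun v hv => (hmn v hv).symm)
    · exact (L1.integrable_coeFn p).congr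
        ((ae_restrict_mem measurableSet_Ioo).mono fun v hv => (hmp v hv).symm)
  have hmw : IntegrableOn (fun v => |v|⁻¹ • m v) (Ioo (-1) 1) := by
    refine integrableOn_Ioo_of_neg_pos ?_ ?_
    · refine (Integrable.neg (hq.sub hGnw)).congr
        ((ae_restrict_mem measurableSet_Ioo).mono fun v hv => ?_)
      change -(|v|⁻¹ • r v) = |v|⁻¹ • m v
      rw [hmn v hv, smul_neg]
    · refine Integrable.congr hp ((ae_restrict_mem measurableSet_Ioo).mono fun v hv => ?_)
      change |v|⁻¹ • p v = |v|⁻¹ • m v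
      rw [hmp v hv]
  have hfi := integrable_characteristicSolution hgm hgi hgw hmm hmw
  set f : L1 𝕜 (phaseSpace a) := hfi.toL1 _ with hf
  have hprim : IntegrableOn (fun v => primitive a g (a, v)) (Ioo (-1) 1) := by
    simp_rw [primitive_right]
    exact integrableOn_integral_slice hgi
  set γm : ℝ → 𝕜 := fun v => v⁻¹ • m v with hγm
  set γp : ℝ → 𝕜 := fun v => v⁻¹ • (m v - primitive a g (a, v)) with hγp
  have hvm : ∀ᵐ v ∂volume.restrict (Ioo (-1 : ℝ) 1), v • γm v = m v :=
    ae_restrict_ne_zero.mono fun v hv => smul_inv_smul₀ hv _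
  have hvp : ∀ᵐ v ∂volume.restrict (Ioo (-1 : ℝ) 1), v • γp v = m v - primitive a g (a, v) :=
    ae_restrict_ne_zero.mono fun v hv => smul_inv_smul₀ hv _
  have htr : IsTrace a f (-g) γm γp := by
    refine ⟨hmi.congr (hvm.mono fun v hv => hv.symm),
      (hmi.sub hprim).congr (hvp.mono fun v hv => hv.symm), fun φ h1 h2 => ?_⟩
    have e1 : ∫ z in phaseSpace a, φ z • (-g : L1 𝕜 (phaseSpace a)) z =
        -∫ z in phaseSpace a, φ z • g z := by
      rw [← integral_neg]
      refine integral_congr_ae ?_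
      filter_upwards [Lp.coeFn_neg g] with z hz
      rw [hz, Pi.neg_apply, smul_neg]
    have e2 : ∫ z in phaseSpace a, (z.2 * dx φ z) • f z =
        ∫ z in phaseSpace a, (z.2 * dx φ z) • characteristicSolution a g m z := by
      refine integral_congr_ae ?_
      filter_upwards [hfi.coeFn_toL1] with z hz
      rw [hf, hz]
    have e3 : ∫ v in Ioo (-1) 1, φ (a, v) • v • γp v =
        ∫ v in Ioo (-1) 1, φ (a, v) • (m v - primitive a g (a, v)) :=
      integral_congr_ae (hvp.mono fun v hv => congrArg (fun y => φ (a, v) • y) hv)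
    have e4 : ∫ v in Ioo (-1) 1, φ (-a, v) • v • γm v = ∫ v in Ioo (-1) 1, φ (-a, v) • m v :=
      integral_congr_ae (hvm.mono fun v hv => congrArg (fun y => φ (-a, v) • y) hv)
    rw [e1, e2, e3, e4]
    exact green_characteristicSolution ha hgm hgi hgw hmm hmi hmw h1 h2
  -- Test functions supported inside the phase space vanish at `x = ±a`, so the boundary terms of
  -- the Green formula disappear.
  have hder : IsTransportDeriv a f (-g) := by
    intro φ h1 h2 h3
    have hz : ∀ x v, x ∉ Ioo (-a) a → φ (x, v) = 0 := fun x v hx =>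
      image_eq_zero_of_notMem_tsupport fun hmem => hx (h3 hmem).1
    have h4 := htr.green φ h1 h2
    have e1 : ∀ v, φ (a, v) = 0 := fun v => hz a v (by simp)
    have e2 : ∀ v, φ (-a, v) = 0 := fun v => hz (-a) v (by simp)
    simp only [e1, e2, zero_smul, integral_zero, sub_self] at h4
    exact eq_neg_of_add_eq_zero_right h4
  have hposf : ∀ {v : ℝ}, v ∈ posVel → ∀ y : 𝕜, |v| • v⁻¹ • y = y := fun {v} hv y => by
    rw [abs_of_pos hv.1, smul_inv_smul₀ hv.1.ne']
  have hnegf : ∀ {v : ℝ}, v ∈ negVel → ∀ y : 𝕜, |v| • v⁻¹ • y = -y := fun {v} hv y => by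
    rw [abs_of_neg hv.2, neg_smul, smul_inv_smul₀ hv.2.ne]
  have hbc : BoundaryCondition a O₁ O₂ f (-g) := by
    refine ⟨γm, γp, htr, r, p, q, p - Gp, ?_, ?_, ?_, ?_, hpe, hqe⟩
    · filter_upwards [ae_restrict_mem measurableSet_Ioo] with v hv
      rw [hγm, hnegf hv, hmn v hv, neg_neg]
    · filter_upwards [ae_restrict_mem measurableSet_Ioo] with v hv
      rw [hγm, hposf hv, hmp v hv]
    · filter_upwards [ae_restrict_mem measurableSet_Ioo, hGn, Lp.coeFn_sub q Gn] with v hv h1 h2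
      rw [hγp, hnegf hv, hmn v hv, primitive_right, ← h1, hr, h2, Pi.sub_apply]
      ring
    · filter_upwards [ae_restrict_mem measurableSet_Ioo, hGp, Lp.coeFn_sub p Gp] with v hv h1 h2
      rw [hγp, hposf hv, hmp v hv, primitive_right, ← h1, h2, Pi.sub_apply]
  refine ⟨⟨f, -g, hder, hbc⟩, ?_⟩
  exact (transportOperator_apply ⟨f, -g, hder, hbc⟩ hder).trans (neg_neg g)

/-- The integrals of `g` along the characteristics, as elements of weighted `L¹` spaces. -/
theorem exists_characteristic_integrals {g : L1 𝕜 (phaseSpace a)}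
    (hgw : IntegrableOn (fun z : ℝ × ℝ => |z.2|⁻¹ • g z) (phaseSpace a))
    (hg0 : ∫ z in phaseSpace a, g z = 0) :
    ∃ (Gp : L1 𝕜 posVel) (Gn : L1 𝕜 negVel),
      (∀ᵐ v ∂volume.restrict posVel, Gp v = ∫ s in Ioo (-a) a, g (s, v)) ∧
      (∀ᵐ v ∂volume.restrict negVel, Gn v = ∫ s in Ioo (-a) a, g (s, v)) ∧
      InvWeightIntegrable Gp ∧ InvWeightIntegrable Gn ∧
      (∫ v in posVel, Gp v) + ∫ v in negVel, Gn v = 0 := by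
  have hgi : IntegrableOn g (phaseSpace a) := L1.integrable_coeFn g
  have h1 : IntegrableOn (fun v => ∫ s in Ioo (-a) a, g (s, v)) (Ioo (-1) 1) :=
    integrableOn_integral_slice hgi
  have h2 : IntegrableOn (fun v => |v|⁻¹ • ∫ s in Ioo (-a) a, g (s, v)) (Ioo (-1) 1) := by
    refine (integrableOn_integral_slice hgw).congr (Filter.Eventually.of_forall fun v => ?_)
    exact integral_smul |v|⁻¹ fun s => g (s, v)
  have hp := (h1.mono_set posVel_subset).coeFn_toL1
  have hn := (h1.mono_set negVel_subset).coeFn_toL1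
  refine ⟨(h1.mono_set posVel_subset).toL1 _, (h1.mono_set negVel_subset).toL1 _, hp, hn, ?_, ?_, ?_⟩
  · exact (h2.mono_set posVel_subset).congr 
      (hp.mono fun v hv => congrArg (fun y => |v|⁻¹ • y) hv.symm)
  · exact (h2.mono_set negVel_subset).congr 
      (hn.mono fun v hv => congrArg (fun y => |v|⁻¹ • y) hv.symm)
  · rw [integral_congr_ae hp, integral_congr_ae hn, add_comm, ← hg0, integral_phaseSpace hgi,
      ← Ioc_union_Ioo_eq_Ioo (show (-1 : ℝ) ≤ 0 by norm_num) (show (0 : ℝ) < 1 by norm_num),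
      setIntegral_union (by
        rw [Set.disjoint_left]
        exact fun v hv hv' => not_lt.2 hv.2 hv'.1) measurableSet_Ioo
        (h1.mono_set (Ioc_subset_Ioo_right (by norm_num))) (h1.mono_set posVel_subset),
      integral_Ioc_eq_integral_Ioo]
    rfl

end SlabTransport

end

theorem mainTheorem8 {𝕜 : Type*} [RCLike 𝕜] (a : ℝ) (ha : 0 < a)
    (α₁ β₁ α₂ β₂ : ℝ) (hα₁ : 0 ≤ α₁) (hβ₁ : 0 ≤ β₁) (hα₂ : 0 ≤ α₂) (hβ₂ : 0 ≤ β₂)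
    (h₁ : α₁ + β₁ = 1) (h₂ : α₂ + β₂ = 1)
    (K₁ : SlabTransport.L1 𝕜 SlabTransport.negVel →L[𝕜] SlabTransport.L1 𝕜 SlabTransport.posVel)
    (K₂ : SlabTransport.L1 𝕜 SlabTransport.posVel →L[𝕜] SlabTransport.L1 𝕜 SlabTransport.negVel)
    (hK₁ : SlabTransport.IsStochastic K₁) (hK₂ : SlabTransport.IsStochastic K₂)
    (hK₁c : SlabTransport.IsWeaklyCompact K₁) (hK₂c : SlabTransport.IsWeaklyCompact K₂)
    (O₁ : SlabTransport.L1 𝕜 SlabTransport.negVel →L[𝕜] SlabTransport.L1 𝕜 SlabTransport.posVel)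
    (O₂ : SlabTransport.L1 𝕜 SlabTransport.posVel →L[𝕜] SlabTransport.L1 𝕜 SlabTransport.negVel)
    (hO₁ : O₁ = SlabTransport.boundaryLeft α₁ β₁ K₁)
    (hO₂ : O₂ = SlabTransport.boundaryRight α₂ β₂ K₂)
    (hcase :
      (O₁ = K₁ ∧ SlabTransport.InvWeightBounded K₁ ∧ SlabTransport.WeightConjBounded K₂ ∧
        SlabTransport.IsIrreducibleOperator (O₁ ∘L O₂)) ∨
      (O₂ = K₂ ∧ SlabTransport.InvWeightBounded K₂ ∧ SlabTransport.WeightConjBounded K₁ ∧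
        SlabTransport.IsIrreducibleOperator (O₂ ∘L O₁)))
    (g : SlabTransport.L1 𝕜 (SlabTransport.phaseSpace a))
    (hg : IntegrableOn (fun z : ℝ × ℝ => |z.2|⁻¹ • g z) (SlabTransport.phaseSpace a))
    (hg0 : ∫ z in SlabTransport.phaseSpace a, g z = 0) :
    g ∈ LinearMap.range (SlabTransport.transportOperator a O₁ O₂).toFun := by
  obtain ⟨Gp, Gn, hGp, hGn, hGpw, hGnw, hsum⟩ :=
    SlabTransport.exists_characteristic_integrals hg hg0
  have hS₁ : SlabTransport.IsStochastic O₁ := hO₁ ▸ SlabTransport.isStochastic_convexComb hα₁ hβ₁ h₁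
    SlabTransport.isStochastic_reflectLeft hK₁
  have hS₂ : SlabTransport.IsStochastic O₂ := hO₂ ▸ SlabTransport.isStochastic_convexComb hα₂ hβ₂ h₂
    SlabTransport.isStochastic_reflectRight hK₂
  rcases hcase with ⟨he, hw, hc, hirr⟩ | ⟨he, hw, hc, hirr⟩
  -- `O₂` preserves weighted integrability: reflection commutes with `|v|⁻¹`, and the summand with
  -- `K₂` is controlled by the conjugated bound.
  · obtain ⟨p, q, hp, hq, hpe, hqe⟩ := SlabTransport.exists_boundary_values measurableSet_Ioo
      hS₁ hS₂ (he ▸ hK₁c) hirr (he ▸ hw) (fun φ hφ => by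
        rw [hO₂]
        exact hφ.reflectRight.convexComb (hc.integrable SlabTransport.ae_restrict_ne_zero hφ) _ _)
      hGpw hsum
    exact SlabTransport.mem_range_of_boundary_values ha hg hGp hGn hp hq hGnw hpe hqe
  -- The boundary system is symmetric under exchange of the walls, so here `p` is eliminated and `q`
  -- is found first.
  · obtain ⟨q, p, hq, hp, hqe, hpe⟩ := SlabTransport.exists_boundary_values measurableSet_Ioo
      hS₂ hS₁ (he ▸ hK₂c) hirr (he ▸ hw) (fun φ hφ => by
        rw [hO₁]
        exact hφ.reflectLeft.convexComb (hc.integrable SlabTransport.ae_restrict_ne_zero hφ) _ _)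
      hGnw (by rw [add_comm]; exact hsum)
    exact SlabTransport.mem_range_of_boundary_values ha hg hGp hGn hp hq hGnw hpe hqe
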